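/- Let $\mathbb T$ be the set of all finite words over the alphabet $\{1,2\}$ (the vertices of the binary tree, with the empty word $\varnothing$ as root), let $I:=[0,1]\cup\{\infty\}$, and define $\gamma:[0,1]\times I^2\to I$ by $\gamma[t](x,y):=x\wedge y$ if $x\wedge y>t$, and $\gamma[t](x,y):=\infty$ otherwise. Let $\nu$ be the probability law on $I$ with $\nu\big((t,1]\cup\{\infty\}\big)=1\wedge\frac1{2t}$ for all $t\in[0,1]$ (where $1/0:=\infty$). A recursive tree process (RTP) corresponding to $\gamma$ and $\nu$ is a family $(\tau_{\mathbf i},X_{\mathbf i})_{\mathbf i\in\mathbb T}$ of random variables, with $\tau_{\mathbf i}\in[0,1]$ and $X_{\mathbf i}\in I$, defined on one probability space, such that: the $(\tau_{\mathbf i})_{\mathbf i\in\mathbb T}$ are i.i.d. uniformly distributed on $[0,1]$; for each finite prefix-closed set $\mathbb U\subset\mathbb T$ with boundary $\partial\mathbb U$ (the set of words outside $\mathbb U$ whose predecessor lies in $\mathbb U$, with $\partial\emptyset:=\{\varnothing\}$), the random variables $(X_{\mathbf i})_{\mathbf i\in\partial\mathbb U}$ are i.i.d. with common law $\nu$ and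 independent of $(\tau_{\mathbf i})_{\mathbf i\in\mathbb U}$; and almost surely $X_{\mathbf i}=\gamma[\tau_{\mathbf i}](X_{\mathbf i1},X_{\mathbf i2})$ for all $\mathbf i\in\mathbb T$. Such an RTP exists, and every such RTP is nonendogenous: the random variable $X_\varnothing$ (the burning time of the root) is not measurable with respect to the $\sigma$-field generated by $(\tau_{\mathbf i})_{\mathbf i\in\mathbb T}$, not even after modification on a null set. -/

import Mathlib

open MeasureTheory ProbabilityTheory

noncomputable section

/-! ### Recursive tree processes on the `d`-ary tree

The word `i₁ ⋯ iₙ` over an alphabet of `d` letters is the list `[i₁, …, iₙ]`; its children are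
`i ++ [k]`, and its predecessor (for `n ≥ 1`) is `i.dropLast`. -/

/-- The vertices of the `d`-ary tree: finite words over an alphabet with `d` letters. -/
abbrev Word (d : ℕ) : Type := List (Fin d)

/-- A (finite) rooted subtree: a set of words that is closed under taking prefixes.
The empty set is allowed. -/
def IsRootedSubtree {d : ℕ} (U : Finset (Word d)) : Prop :=
  ∀ i j : Word d, i <+: j → j ∈ U → i ∈ U

/-- The boundary of a rooted subtree `U`: the words outside `U` whose predecessor lies in `U`,
with the convention that the boundary of the empty subtree consists of the root only. -/
def treeBoundary {d : ℕ} (U : Finset (Word d)) : Set (Word d) :=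
  if U = ∅ then {[]} else {i | i ∉ U ∧ i ≠ [] ∧ i.dropLast ∈ U}

/-- `(ω, X)`, defined on the probability space `(S, P)`, is a recursive tree process
corresponding to the map `γ : Ω × I ^ d → I`, the law `p` on `Ω` and the law `ν` on `I`. -/
structure IsRTP {d : ℕ} {Ω I S : Type*} [MeasurableSpace Ω] [MeasurableSpace I]
    [MeasurableSpace S] (p : Measure Ω) (γ : Ω → (Fin d → I) → I) (ν : Measure I)
    (P : Measure S) (ω : Word d → S → Ω) (X : Word d → S → I) : Prop where
  measurable_noise : ∀ i, Measurable (ω i)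
  measurable_state : ∀ i, Measurable (X i)
  /-- the noise variables are independent ... -/
  iIndepFun_noise : iIndepFun ω P
  /-- ... with common law `p` -/
  map_noise : ∀ i, P.map (ω i) = p
  /-- on the boundary of each finite rooted subtree the states are independent ... -/
  iIndepFun_boundary : ∀ U : Finset (Word d), IsRootedSubtree U →
    iIndepFun (fun i : treeBoundary U => X i) P
  /-- ... with common law `ν` ... -/
  map_boundary : ∀ U : Finset (Word d), IsRootedSubtree U →
    ∀ i ∈ treeBoundary U, P.map (X i) = ν
  /-- ... and they are jointly independent of the noise inside the subtree -/
  indepFun_boundary_noise : ∀ U : Finset (Word d), IsRootedSubtree U →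
    IndepFun (fun s => fun i : treeBoundary U => X i s) (fun s => fun i : U => ω i s) P
  /-- the state at a vertex is a function of the noise at this vertex and of the states of its
  children -/
  recursion : ∀ i, ∀ᵐ s ∂P, X i s = γ (ω i s) (fun k => X (i ++ [k]) s)

/-- Endogeny: up to a null set, the state at the root is measurable with respect to the
`σ`-field generated by all noise variables. -/
def IsEndogenous {d : ℕ} {Ω I S : Type*} [MeasurableSpace Ω] [MeasurableSpace I]
    [MeasurableSpace S] (P : Measure S) (ω : Word d → S → Ω) (X : Word d → S → I) : Prop :=
  ∃ Y : S → I, Measurable[⨆ i : Word d, MeasurableSpace.comap (ω i) inferInstance] Y ∧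
    X [] =ᵐ[P] Y

/-! ### Frozen percolation on the binary tree -/

/-- The space `[0,1] ∪ {∞}` of burning times, with its order topology (in which `∞` is isolated)
and Borel `σ`-field. -/
abbrev BurnTime : Type := WithTop unitInterval

/-- `γ[t](x, y) = x ∧ y` if `x ∧ y > t`, and `∞` otherwise. -/
def frozenMap (t : unitInterval) (x y : BurnTime) : BurnTime :=
  if (t : BurnTime) < min x y then min x y else ⊤

/-- The decreasing quantile function of the law `ν` below: `u ↦ 1 / (2 u)` if `u ≥ 1 / 2`, and
`u ↦ ∞` otherwise. -/
def burnQuantile (u : unitInterval) : BurnTime :=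
  if 1 / 2 ≤ (u : ℝ) then
    ((Set.projIcc (0 : ℝ) 1 zero_le_one (1 / (2 * (u : ℝ))) : unitInterval) : BurnTime)
  else ⊤

/-- The law `ν` on `[0,1] ∪ {∞}` with `ν ((t,1] ∪ {∞}) = 1 ∧ 1 / (2 t)` for all `t ∈ [0,1]`,
constructed as the image of the uniform distribution under the quantile function; see
`eq_burnLaw_iff` for the characterization through its tail. -/
def burnLaw : Measure BurnTime := (volume : Measure unitInterval).map burnQuantile

lemma measurable_burnQuantile : Measurable burnQuantile := by
  unfold burnQuantile
  refine Measurable.ite ?_ ?_ measurable_const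
  · exact measurableSet_le measurable_const measurable_subtype_coe
  · refine Measurable.withTop_coe ?_
    refine continuous_projIcc.measurable.comp ?_
    exact measurable_const.div (measurable_const.mul measurable_subtype_coe)

instance : IsProbabilityMeasure burnLaw :=
  Measure.isProbabilityMeasure_map measurable_burnQuantile.aemeasurable

/-- In `WithTop [0,1]`, the interval `(t, ∞]` is `(t,1] ∪ {∞}`; in `ℝ≥0∞` one has `1 / 0 = ∞`, so
that the right-hand side is `1` for `t = 0`. -/
lemma burnLaw_Ioi (t : unitInterval) :
    burnLaw (Set.Ioi (t : BurnTime)) = min 1 (1 / (2 * ENNReal.ofReal t)) := by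
  have ht0 : (0 : ℝ) ≤ t := t.2.1
  have ht1 : (t : ℝ) ≤ 1 := t.2.2
  rw [burnLaw, Measure.map_apply measurable_burnQuantile measurableSet_Ioi, unitInterval.volume_apply]
  have key : ∀ u : unitInterval, (t : BurnTime) < burnQuantile u ↔ 2 * (t : ℝ) * u < 1 := by
    intro u
    have hu0 : (0 : ℝ) ≤ u := u.2.1
    have hu1 : (u : ℝ) ≤ 1 := u.2.2
    unfold burnQuantile
    split_ifs with h
    · have hm : (1 / (2 * (u : ℝ))) ∈ Set.Icc (0 : ℝ) 1 := by
        constructor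
        · positivity
        · rw [div_le_one (by linarith)]; linarith
      rw [Set.projIcc_of_mem zero_le_one hm, WithTop.coe_lt_coe, ← Subtype.coe_lt_coe]
      show (t : ℝ) < 1 / (2 * (u : ℝ)) ↔ _
      rw [lt_div_iff₀ (by linarith)]
      constructor <;> intro h <;> linarith
    · simp only [WithTop.coe_lt_top, true_iff]
      push Not at h
      nlinarith
  by_cases h : (t : ℝ) < 1 / 2
  · have h1 : Subtype.val '' (burnQuantile ⁻¹' Set.Ioi (t : BurnTime)) = Set.Icc (0 : ℝ) 1 := by
      ext x
      simp only [Set.mem_image, Set.mem_preimage, Set.mem_Ioi, key]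
      constructor
      · rintro ⟨u, -, rfl⟩; exact u.2
      · intro hx
        exact ⟨⟨x, hx⟩, by show 2 * (t : ℝ) * x < 1; nlinarith [hx.1, hx.2], rfl⟩
    rw [h1, Real.volume_Icc, min_eq_left]
    · simp
    · rw [ENNReal.le_div_iff_mul_le (by simp) (by simp), one_mul]
      have h2 : (2 : ENNReal) = ENNReal.ofReal 2 := by simp
      rw [h2, ← ENNReal.ofReal_mul (by norm_num), ← ENNReal.ofReal_one]
      exact ENNReal.ofReal_le_ofReal (by linarith)
  · push Not at h
    have h1 : Subtype.val '' (burnQuantile ⁻¹' Set.Ioi (t : BurnTime))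
        = Set.Ico (0 : ℝ) (1 / (2 * t)) := by
      ext x
      simp only [Set.mem_image, Set.mem_preimage, Set.mem_Ioi, key, Set.mem_Ico]
      rw [lt_div_iff₀ (by linarith)]
      constructor
      · rintro ⟨u, hu, rfl⟩; exact ⟨u.2.1, by linarith⟩
      · rintro ⟨hx0, hx1⟩
        refine ⟨⟨x, hx0, ?_⟩, by show 2 * (t : ℝ) * x < 1; linarith, rfl⟩
        nlinarith
    have h3 : ENNReal.ofReal (1 / (2 * t)) = 1 / (2 * ENNReal.ofReal t) := by
      rw [ENNReal.ofReal_div_of_pos (by linarith), ENNReal.ofReal_mul (by norm_num)]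
      simp
    rw [h1, Real.volume_Ico, sub_zero, h3, min_eq_right]
    rw [← h3, ← ENNReal.ofReal_one]
    refine ENNReal.ofReal_le_ofReal ?_
    rw [div_le_one (by linarith)]
    linarith

/-- `burnLaw` is the only probability law with the prescribed tail. -/
lemma eq_burnLaw_iff (ν : Measure BurnTime) [IsProbabilityMeasure ν] :
    ν = burnLaw ↔ ∀ t : unitInterval,
      ν (Set.Ioi (t : BurnTime)) = min 1 (1 / (2 * ENNReal.ofReal t)) := by
  constructor
  · rintro rfl t
    exact burnLaw_Ioi t
  · intro h
    refine Measure.ext_of_Iic ν burnLaw fun a => ?_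
    have h2 : ν (Set.Ioi a) = burnLaw (Set.Ioi a) := by
      induction a using WithTop.recTopCoe with
      | top => simp
      | coe t => rw [h t, burnLaw_Ioi t]
    rw [← Set.compl_Ioi, prob_compl_eq_one_sub measurableSet_Ioi,
      prob_compl_eq_one_sub measurableSet_Ioi, h2]

end

/-! Nonendogeny is proved by exhibiting two different families of states over the same noise. The
core is a law on pairs of burning times that has both marginals `burnLaw`, is invariant when both
coordinates evolve with the same activation times (`map_frozenPairMap_coupling`), and yet charges
the pairs whose first coordinate alone is infinite (`coupling_top_compl_ne_zero`). An invariant law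
always carries a recursive tree process (`exists_isRTP`). Applied to the pair recursion and
projected to each coordinate (`map_state`), this yields two processes over one noise, and in
particular existence. The joint law of the noise and the root state is determined by the
characteristics of a process (`measure_noise_root_eq`). Endogeny of any one process would therefore
make the root state the same function of the noise in all of them, so the two projections would
agree at the root (`measure_root_ne_eq_zero`), which they do not.

To find the coupling, replace a time `t` by its level `burnCDF t`; in levels, the finite part of
`burnLaw` is Lebesgue measure on `(0, 1/2]`. One looks for a symmetric law for which, if `a ≤ b`,
the event that the first level exceeds `a` and the second is at most `b` has mass `b * w (a / b)`.
With `F` the joint tail, invariance says that the integral of `F(u,u)² - F(s,u)² - F(u,t)² +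
F(s,t)²` over `u` between `0` and `min s t` is the mass of `[0,s] × [0,t]`. This integral can be
evaluated (`integral_tail_of_le`) as soon as `w * (w' + 1) = k * x`, `w 0 = 1`, `w 1 = z` and `2 * k
= z * (z + 1)`. The diagonal coupling is the degenerate solution `w = 1 - x`, `k = z = 0`; what is
needed is a solution with `z > 0`. Setting `x = g`, `w = g'` linearises the equation to `g'' + g' =
k * g` (`exists_isProfile`), and the boundary conditions reduce to one scalar equation, solved by
the intermediate value theorem (`exists_profile_parameters`). -/

/-! ### Existence of recursive tree processes -/

/-- If `ν` is invariant under the recursion, then the noise and the states of the children of a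
vertex can be sampled from the state at the vertex and an independent uniform variable. -/
lemma exists_backward_sampler {d : ℕ} {Ω I : Type*} [MeasurableSpace Ω] [MeasurableSpace I]
    [StandardBorelSpace Ω] [StandardBorelSpace I] [Nonempty Ω] [Nonempty I]
    {p : Measure Ω} [IsProbabilityMeasure p] {ν : Measure I} [IsProbabilityMeasure ν]
    {γ : Ω → (Fin d → I) → I} (hγ : Measurable (Function.uncurry γ))
    (hν : (p.prod (Measure.pi fun _ : Fin d => ν)).map (Function.uncurry γ) = ν) :
    ∃ K : I × unitInterval → Ω × (Fin d → I), Measurable K ∧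
      (ν.prod volume).map K = p.prod (Measure.pi fun _ : Fin d => ν) ∧
      ∀ᵐ y ∂(ν.prod volume), Function.uncurry γ (K y) = y.1 := by
  set π := p.prod (Measure.pi fun _ : Fin d => ν) with hπ
  set ρ : Measure (I × (Ω × (Fin d → I))) := π.map fun y => (Function.uncurry γ y, y) with hρ
  have hm : Measurable fun y : Ω × (Fin d → I) => (Function.uncurry γ y, y) :=
    hγ.prodMk measurable_id
  have : IsProbabilityMeasure ρ := Measure.isProbabilityMeasure_map hm.aemeasurable
  have hfst : ρ.fst = ν := by
    rw [hρ, Measure.fst, Measure.map_map measurable_fst hm]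
    exact hν
  have hsnd : ρ.map Prod.snd = π := by
    rw [hρ, Measure.map_map measurable_snd hm]
    exact Measure.map_id
  -- The sampler realises the conditional law of the arguments of `γ`, given its value, as the image
  -- of a uniform variable.
  obtain ⟨f, hf, hfκ⟩ := Kernel.exists_measurable_map_eq_unitInterval ρ.condKernel
  have hg : Measurable fun y : I × unitInterval => (y.1, Function.uncurry f y) :=
    measurable_fst.prodMk hf
  have key : (ν.prod volume).map (fun y : I × unitInterval => (y.1, Function.uncurry f y)) = ρ := by
    rw [← ρ.disintegrate ρ.condKernel, hfst]
    ext s hs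
    rw [Measure.map_apply hg hs, Measure.prod_apply (hg hs), Measure.compProd_apply hs]
    refine lintegral_congr fun a => ?_
    rw [← hfκ a, Measure.map_apply (hf.of_uncurry_left (x := a)) (measurable_prodMk_left hs)]
    rfl
  refine ⟨Function.uncurry f, hf, ?_, ?_⟩
  · rw [← hsnd, ← key, Measure.map_map measurable_snd hg]
    rfl
  · have hset : MeasurableSet {w : I × (Ω × (Fin d → I)) | Function.uncurry γ w.2 = w.1} :=
      measurableSet_eq_fun (hγ.comp measurable_snd) measurable_fst
    have h1 : ∀ᵐ w ∂ρ, Function.uncurry γ w.2 = w.1 := by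
      rw [hρ, ae_map_iff hm.aemeasurable hset]
      exact Filter.Eventually.of_forall fun _ => rfl
    rw [← key, ae_map_iff hg.aemeasurable hset] at h1
    exact h1

/-! ### Rooted subtrees and their boundaries. -/

section Boundary

variable {d : ℕ}

lemma mem_treeBoundary_empty {i : Word d} : i ∈ treeBoundary (∅ : Finset (Word d)) ↔ i = [] := by
  simp [treeBoundary]

lemma mem_treeBoundary_of_nonempty {U : Finset (Word d)} (hU : U.Nonempty) {i : Word d} :
    i ∈ treeBoundary U ↔ i ∉ U ∧ i ≠ [] ∧ i.dropLast ∈ U := by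
  simp [treeBoundary, hU.ne_empty]

lemma notMem_of_mem_treeBoundary {U : Finset (Word d)} {i : Word d} (hi : i ∈ treeBoundary U) :
    i ∉ U := by
  rcases U.eq_empty_or_nonempty with rfl | hU
  · simp
  · exact ((mem_treeBoundary_of_nonempty hU).1 hi).1

lemma finite_treeBoundary (U : Finset (Word d)) : (treeBoundary U).Finite := by
  refine ((Set.finite_singleton ([] : Word d)).union
    ((U.finite_toSet.prod (Set.finite_univ (α := Fin d))).image
      fun q : Word d × Fin d => q.1 ++ [q.2])).subset ?_
  intro i hi
  rcases U.eq_empty_or_nonempty with rfl | hU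
  · exact Or.inl (mem_treeBoundary_empty.1 hi)
  · obtain ⟨-, h1, h2⟩ := (mem_treeBoundary_of_nonempty hU).1 hi
    exact Or.inr ⟨(i.dropLast, i.getLast h1), ⟨h2, trivial⟩, List.dropLast_append_getLast h1⟩

lemma append_singleton_notMem_of_mem_treeBoundary {U : Finset (Word d)} (hU : IsRootedSubtree U)
    {v : Word d} (hv : v ∈ treeBoundary U) (k : Fin d) : v ++ [k] ∉ U :=
  fun h => notMem_of_mem_treeBoundary hv (hU _ _ (List.prefix_append _ _) h)

lemma append_singleton_notMem_treeBoundary {U : Finset (Word d)}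
    {v : Word d} (hv : v ∈ treeBoundary U) (k : Fin d) : v ++ [k] ∉ treeBoundary U := by
  intro h
  rcases U.eq_empty_or_nonempty with rfl | hne
  · simp [mem_treeBoundary_empty] at h
  · have := ((mem_treeBoundary_of_nonempty hne).1 h).2.2
    rw [List.dropLast_concat] at this
    exact notMem_of_mem_treeBoundary hv this

lemma mem_treeBoundary_insert {U : Finset (Word d)} (hU : IsRootedSubtree U)
    {v : Word d} (hv : v ∈ treeBoundary U) {i : Word d} :
    i ∈ treeBoundary (insert v U) ↔ (i ∈ treeBoundary U ∧ i ≠ v) ∨ ∃ k, i = v ++ [k] := by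
  have hvU := notMem_of_mem_treeBoundary hv
  rw [mem_treeBoundary_of_nonempty (Finset.insert_nonempty v U)]
  constructor
  · rintro ⟨h1, h2, h3⟩
    rw [Finset.mem_insert, not_or] at h1
    rcases Finset.mem_insert.1 h3 with h | h
    · refine Or.inr ⟨i.getLast h2, ?_⟩
      rw [← h, List.dropLast_append_getLast]
    · exact Or.inl ⟨(mem_treeBoundary_of_nonempty ⟨_, h⟩).2 ⟨h1.2, h2, h⟩, h1.1⟩
  · rintro (⟨h1, h2⟩ | ⟨k, rfl⟩)
    · rcases U.eq_empty_or_nonempty with rfl | hne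
      · rw [mem_treeBoundary_empty] at hv h1
        exact absurd (h1.trans hv.symm) h2
      · obtain ⟨h3, h4, h5⟩ := (mem_treeBoundary_of_nonempty hne).1 h1
        exact ⟨by simp [h2, h3], h4, by simp [h5]⟩
    · refine ⟨?_, by simp, by simp⟩
      rw [Finset.mem_insert, not_or]
      exact ⟨by simp, append_singleton_notMem_of_mem_treeBoundary hU hv k⟩

/-- Every nonempty rooted subtree arises from a smaller one by adding a boundary vertex. -/
@[elab_as_elim]
lemma IsRootedSubtree.induction {motive : Finset (Word d) → Prop} (empty : motive ∅)
    (insert : ∀ U v, IsRootedSubtree U → v ∈ treeBoundary U → motive U → motive (insert v U))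
    (U : Finset (Word d)) (hU : IsRootedSubtree U) : motive U := by
  induction hn : U.card generalizing U with
  | zero => rwa [Finset.card_eq_zero.1 hn]
  | succ n ih =>
    have hne : U.Nonempty := Finset.card_pos.1 (by omega)
    -- A longest word can be removed: it is not a proper prefix of any other element of `U`.
    obtain ⟨v, hv, hmax⟩ := U.exists_max_image List.length hne
    have hr : IsRootedSubtree (U.erase v) := by
      intro i j hij hj
      have hjU := Finset.mem_of_mem_erase hj
      refine Finset.mem_erase.2 ⟨?_, hU i j hij hjU⟩
      rintro rfl
      exact Finset.ne_of_mem_erase hj (hij.eq_of_length_le (hmax j hjU)).symm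
    have hb : v ∈ treeBoundary (U.erase v) := by
      by_cases hv0 : v = []
      · have : U.erase v = ∅ := by
          refine Finset.eq_empty_of_forall_notMem fun j hj => ?_
          have h1 := hmax j (Finset.mem_of_mem_erase hj)
          subst hv0
          exact Finset.ne_of_mem_erase hj (List.eq_nil_of_length_eq_zero (by simpa using h1))
        rw [this, mem_treeBoundary_empty]
        exact hv0
      · have hd : v.dropLast ∈ U.erase v := by
          refine Finset.mem_erase.2 ⟨fun h => ?_, hU _ _ (List.dropLast_prefix v) hv⟩
          have h1 := congrArg List.length h
          rw [List.length_dropLast] at h1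
          have := List.length_pos_iff.2 hv0
          omega
        exact (mem_treeBoundary_of_nonempty ⟨_, hd⟩).2 ⟨Finset.notMem_erase v U, hv0, hd⟩
    have := insert _ v hr hb (ih _ hr (by rw [Finset.card_erase_of_mem hv, hn]; rfl))
    rwa [Finset.insert_erase hv] at this

end Boundary

/-! ### Reduction of the distributional axioms to a product formula. -/

/-- A product formula for the joint law of the noise inside a rooted subtree and the states on its
boundary. -/
def HasBoundaryLaw {d : ℕ} {Ω I S : Type*} [MeasurableSpace Ω] [MeasurableSpace I]
    [MeasurableSpace S] (p : Measure Ω) (ν : Measure I) (P : Measure S) (ω : Word d → S → Ω)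
    (X : Word d → S → I) (U : Finset (Word d)) : Prop :=
  ∀ (A : Word d → Set Ω) (B : Word d → Set I), (∀ i, MeasurableSet (A i)) →
    (∀ i, MeasurableSet (B i)) →
    P ((⋂ i ∈ U, ω i ⁻¹' A i) ∩ ⋂ i ∈ (finite_treeBoundary U).toFinset, X i ⁻¹' B i)
      = (∏ i ∈ U, p (A i)) * ∏ i ∈ (finite_treeBoundary U).toFinset, ν (B i)

section BoundaryLaw

variable {d : ℕ} {Ω I S : Type*} [MeasurableSpace Ω] [MeasurableSpace I]
  [MeasurableSpace S] {p : Measure Ω} {ν : Measure I} {P : Measure S} {ω : Word d → S → Ω}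
  {X : Word d → S → I}

/-- The set of all words of length less than `n`. -/
noncomputable def ball (d n : ℕ) : Finset (Word d) := (List.finite_length_lt (Fin d) n).toFinset

lemma mem_ball {n : ℕ} {i : Word d} : i ∈ ball d n ↔ i.length < n := by simp [ball]

lemma isRootedSubtree_ball (n : ℕ) : IsRootedSubtree (ball d n) := by
  intro i j hij hj
  rw [mem_ball] at hj ⊢
  exact hij.length_le.trans_lt hj

lemma mem_treeBoundary_ball {n : ℕ} {i : Word d} : i ∈ treeBoundary (ball d n) ↔ i.length = n := by
  cases n with
  | zero =>
    have : ball d 0 = ∅ := Finset.eq_empty_of_forall_notMem fun i hi => by simp [mem_ball] at hi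
    rw [this, mem_treeBoundary_empty, List.length_eq_zero_iff]
  | succ n =>
    have : (ball d (n + 1)).Nonempty := ⟨[], by simp [mem_ball]⟩
    rw [mem_treeBoundary_of_nonempty this, mem_ball, mem_ball, List.length_dropLast]
    constructor
    · rintro ⟨h1, -, h3⟩; omega
    · intro h
      refine ⟨by omega, ?_, by omega⟩
      rintro rfl
      simp at h

lemma exists_subset_ball (J : Finset (Word d)) : ∃ n, J ⊆ ball d n :=
  ⟨J.sup List.length + 1, fun _ hi => mem_ball.2 (Nat.lt_succ_of_le (Finset.le_sup hi))⟩

/-- If the boundary law is correct then so are all distributional requirements on a recursive tree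
process. -/
lemma IsRTP.of_hasBoundaryLaw [IsProbabilityMeasure p] [IsProbabilityMeasure ν]
    [IsProbabilityMeasure P] {γ : Ω → (Fin d → I) → I}
    (hω : ∀ i, Measurable (ω i)) (hX : ∀ i, Measurable (X i))
    (hlaw : ∀ U, IsRootedSubtree U → HasBoundaryLaw p ν P ω X U)
    (hrec : ∀ i, ∀ᵐ s ∂P, X i s = γ (ω i s) (fun k => X (i ++ [k]) s)) :
    IsRTP p γ ν P ω X := by
  classical
  have hnoise : ∀ (J : Finset (Word d)) (A : Word d → Set Ω), (∀ i ∈ J, MeasurableSet (A i)) →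
      P (⋂ i ∈ J, ω i ⁻¹' A i) = ∏ i ∈ J, p (A i) := by
    intro J A hA
    obtain ⟨n, hn⟩ := exists_subset_ball J
    -- Trivial constraints outside `J` and on the boundary contribute factors equal to one.
    have := hlaw _ (isRootedSubtree_ball n) (fun i => if i ∈ J then A i else Set.univ)
      (fun _ => Set.univ) (fun i => by
        by_cases hi : i ∈ J
        · simpa [hi] using hA i hi
        · simp [hi]) (fun _ => MeasurableSet.univ)
    simp only [Set.preimage_univ, Set.iInter_univ, Set.inter_univ, measure_univ,
      Finset.prod_const_one, mul_one] at this
    rw [← Finset.prod_subset hn (f := fun i => p (if i ∈ J then A i else Set.univ))] at this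
    · rw [Finset.prod_congr rfl (g := fun i => p (A i)) (fun i hi => by rw [if_pos hi])] at this
      rw [← this]
      congr 1
      ext s
      simp only [Set.mem_iInter, Set.mem_preimage]
      constructor
      · intro h i _
        by_cases hi : i ∈ J
        · simpa [hi] using h i hi
        · simp [hi]
      · intro h i hi
        simpa [hi] using h i (hn hi)
    · intro i _ hi
      simp [hi]
  have hstate : ∀ (U : Finset (Word d)), IsRootedSubtree U → ∀ (J : Finset (Word d))
      (B : Word d → Set I), (∀ i ∈ J, MeasurableSet (B i)) → (∀ i ∈ J, i ∈ treeBoundary U) →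
      P (⋂ i ∈ J, X i ⁻¹' B i) = ∏ i ∈ J, ν (B i) := by
    intro U hU J B hB hJ
    have hn : J ⊆ (finite_treeBoundary U).toFinset := fun i hi => by simpa using hJ i hi
    have := hlaw _ hU (fun _ => Set.univ) (fun i => if i ∈ J then B i else Set.univ)
      (fun _ => MeasurableSet.univ) (fun i => by
        by_cases hi : i ∈ J
        · simpa [hi] using hB i hi
        · simp [hi])
    simp only [Set.preimage_univ, Set.iInter_univ, Set.univ_inter, measure_univ,
      Finset.prod_const_one, one_mul] at this
    rw [← Finset.prod_subset hn (f := fun i => ν (if i ∈ J then B i else Set.univ))] at this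
    · rw [Finset.prod_congr rfl (g := fun i => ν (B i)) (fun i hi => by rw [if_pos hi])] at this
      rw [← this]
      congr 1
      ext s
      simp only [Set.mem_iInter, Set.mem_preimage]
      constructor
      · intro h i _
        by_cases hi : i ∈ J
        · simpa [hi] using h i hi
        · simp [hi]
      · intro h i hi
        simpa [hi] using h i (hn hi)
    · intro i _ hi
      simp [hi]
  have hmapω : ∀ i, P.map (ω i) = p := by
    intro i
    ext A hA
    rw [Measure.map_apply (hω i) hA]
    simpa using hnoise {i} (fun _ => A) (fun _ _ => hA)
  have hmapX : ∀ U : Finset (Word d), IsRootedSubtree U →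
      ∀ i ∈ treeBoundary U, P.map (X i) = ν := by
    intro U hU i hi
    ext B hB
    rw [Measure.map_apply (hX i) hB]
    simpa using hstate U hU {i} (fun _ => B) (fun _ _ => hB) (by simpa using hi)
  refine ⟨hω, hX, ?_, hmapω, ?_, hmapX, ?_, hrec⟩
  · rw [iIndepFun_iff_measure_inter_preimage_eq_mul]
    intro J A hA
    rw [hnoise J A hA]
    refine Finset.prod_congr rfl fun i hi => ?_
    rw [← hmapω i, Measure.map_apply (hω i) (hA i hi)]
  · intro U hU
    rw [iIndepFun_iff_measure_inter_preimage_eq_mul]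
    intro J B hB
    have h1 := hstate U hU (J.map (Function.Embedding.subtype _))
      (fun i => if h : i ∈ treeBoundary U then B ⟨i, h⟩ else ∅) (by
        intro i hi
        obtain ⟨j, hj, rfl⟩ := Finset.mem_map.1 hi
        simpa using hB j hj) (by
        intro i hi
        obtain ⟨j, hj, rfl⟩ := Finset.mem_map.1 hi
        exact j.2)
    have h2 : (⋂ i ∈ J.map (Function.Embedding.subtype _),
        X i ⁻¹' (if h : i ∈ treeBoundary U then B ⟨i, h⟩ else ∅))
        = ⋂ i ∈ J, X (i : Word d) ⁻¹' B i := by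
      ext s
      simp only [Set.mem_iInter, Finset.forall_mem_map, Function.Embedding.subtype_apply,
        Subtype.coe_prop, dite_true, Subtype.coe_eta]
    rw [h2, Finset.prod_map] at h1
    simp only [Function.Embedding.subtype_apply, Subtype.coe_prop, dite_true,
      Subtype.coe_eta] at h1
    rw [h1]
    refine Finset.prod_congr rfl fun i hi => ?_
    rw [← hmapX U hU i i.2, Measure.map_apply (hX i) (hB i hi)]
  · intro U hU
    have : Finite (treeBoundary U) := finite_treeBoundary U
    rw [IndepFun_iff_Indep, ← generateFrom_pi, ← generateFrom_pi, MeasurableSpace.comap_generateFrom,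
      MeasurableSpace.comap_generateFrom]
    have hb := fun i : treeBoundary U => hX i
    refine IndepSets.indep' ?_ ?_ (isPiSystem_pi.comap _) (isPiSystem_pi.comap _) ?_
    · rintro _ ⟨_, ⟨B, hB, rfl⟩, rfl⟩
      exact (measurable_pi_lambda _ hb) (MeasurableSet.univ_pi fun i => hB i trivial)
    · rintro _ ⟨_, ⟨A, hA, rfl⟩, rfl⟩
      exact (measurable_pi_lambda _ fun i : U => hω i)
        (MeasurableSet.univ_pi fun i => hA i trivial)
    · rw [IndepSets_iff]
      rintro _ _ ⟨_, ⟨B, hB, rfl⟩, rfl⟩ ⟨_, ⟨A, hA, rfl⟩, rfl⟩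
      set B' : Word d → Set I := fun i => if h : i ∈ treeBoundary U then B ⟨i, h⟩ else Set.univ
      set A' : Word d → Set Ω := fun i => if h : i ∈ U then A ⟨i, h⟩ else Set.univ
      have hB' : ∀ i, MeasurableSet (B' i) := fun i => by
        by_cases h : i ∈ treeBoundary U
        · simpa [B', h] using hB ⟨i, h⟩ trivial
        · simp [B', h]
      have hA' : ∀ i, MeasurableSet (A' i) := fun i => by
        by_cases h : i ∈ U
        · simpa [A', h] using hA ⟨i, h⟩ trivial
        · simp [A', h]
      have e1 : (fun s => fun i : treeBoundary U => X i s) ⁻¹' (Set.univ.pi B)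
          = ⋂ i ∈ (finite_treeBoundary U).toFinset, X i ⁻¹' B' i := by
        ext s
        simp only [Set.mem_preimage, Set.mem_pi, Set.mem_univ, true_imp_iff, Set.mem_iInter,
          Set.Finite.mem_toFinset, Subtype.forall]
        exact forall₂_congr fun i hi => by simp [B', hi]
      have e2 : (fun s => fun i : U => ω i s) ⁻¹' (Set.univ.pi A)
          = ⋂ i ∈ U, ω i ⁻¹' A' i := by
        ext s
        simp only [Set.mem_preimage, Set.mem_pi, Set.mem_univ, true_imp_iff, Set.mem_iInter,
          Subtype.forall]
        exact forall₂_congr fun i hi => by simp [A', hi]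
      rw [e1, e2, Set.inter_comm, hlaw U hU A' B' hA' hB',
        hstate U hU _ B' (fun i _ => hB' i) (fun i hi => by simpa using hi),
        hnoise U A' (fun i _ => hA' i), mul_comm]

end BoundaryLaw

/-! ### Construction of the process from the root downwards. -/

section Construction

variable {d : ℕ} {Ω I : Type*}

/-- The state at the vertex with reversed word `i`, obtained by running the sampler `K` down the
tree. -/
def downwardStateRev (K : I × unitInterval → Ω × (Fin d → I)) :
    Word d → I × (Word d → unitInterval) → I
  | [], s => s.1
  | k :: i, s => (K (downwardStateRev K i s, s.2 i.reverse)).2 k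

/-- The states obtained by running the sampler `K` down the tree. -/
def downwardState (K : I × unitInterval → Ω × (Fin d → I)) (i : Word d)
    (s : I × (Word d → unitInterval)) : I :=
  downwardStateRev K i.reverse s

/-- The noise obtained by running the sampler `K` down the tree. -/
def downwardNoise (K : I × unitInterval → Ω × (Fin d → I)) (i : Word d)
    (s : I × (Word d → unitInterval)) : Ω :=
  (K (downwardState K i s, s.2 i)).1

variable {K : I × unitInterval → Ω × (Fin d → I)}

lemma downwardState_nil (s : I × (Word d → unitInterval)) : downwardState K [] s = s.1 := rfl

lemma downwardState_append_singleton (i : Word d) (k : Fin d) (s : I × (Word d → unitInterval)) :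
    downwardState K (i ++ [k]) s = (K (downwardState K i s, s.2 i)).2 k := by
  simp [downwardState, downwardStateRev]

variable [MeasurableSpace Ω] [MeasurableSpace I]

lemma measurable_downwardState (hK : Measurable K) (i : Word d) :
    Measurable (downwardState K i) := by
  induction i using List.reverseRecOn with
  | nil => exact measurable_fst
  | append_singleton i k ih =>
    simp only [funext (downwardState_append_singleton (K := K) i k)]
    have h : Measurable fun s : I × (Word d → unitInterval) => (downwardState K i s, s.2 i) :=
      ih.prodMk ((measurable_pi_apply i).comp measurable_snd)
    exact (measurable_pi_apply k).comp (measurable_snd.comp (hK.comp h))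

lemma measurable_downwardNoise (hK : Measurable K) (i : Word d) :
    Measurable (downwardNoise K i) :=
  measurable_fst.comp (hK.comp ((measurable_downwardState hK i).prodMk
    ((measurable_pi_apply i).comp measurable_snd)))

open Classical in
/-- The constraint at the vertex `i` when the vertices of `U` have been explored. -/
def exploredEvent (K : I × unitInterval → Ω × (Fin d → I)) (A : Word d → Set Ω)
    (B : Word d → Set I) (C : Word d → Set unitInterval) (U : Finset (Word d)) (i : Word d) :
    Set (I × (Word d → unitInterval)) :=
  if i ∈ U then downwardNoise K i ⁻¹' A i
  else if i ∈ treeBoundary U then downwardState K i ⁻¹' B i ∩ (fun s => s.2 i) ⁻¹' C i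
  else (fun s => s.2 i) ⁻¹' C i

open Classical in
/-- The probability of `exploredEvent`. -/
noncomputable def exploredWeight (p : Measure Ω) (ν : Measure I) (A : Word d → Set Ω)
    (B : Word d → Set I) (C : Word d → Set unitInterval) (U : Finset (Word d)) (i : Word d) :
    ENNReal :=
  if i ∈ U then p (A i)
  else if i ∈ treeBoundary U then ν (B i) * volume (C i)
  else volume (C i)

lemma measurableSet_exploredEvent (hK : Measurable K) {A : Word d → Set Ω}
    {B : Word d → Set I} {C : Word d → Set unitInterval} (hA : ∀ i, MeasurableSet (A i))
    (hB : ∀ i, MeasurableSet (B i)) (hC : ∀ i, MeasurableSet (C i)) (U : Finset (Word d))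
    (i : Word d) : MeasurableSet (exploredEvent K A B C U i) := by
  have hu : MeasurableSet ((fun s : I × (Word d → unitInterval) => s.2 i) ⁻¹' C i) :=
    ((measurable_pi_apply i).comp measurable_snd) (hC i)
  unfold exploredEvent
  split_ifs
  · exact measurable_downwardNoise hK i (hA i)
  · exact (measurable_downwardState hK i (hB i)).inter hu
  · exact hu

/-- The tree explored up to `U` consists of independent pieces. -/
lemma measure_iInter_exploredEvent {p : Measure Ω} [IsProbabilityMeasure p] {ν : Measure I}
    [IsProbabilityMeasure ν] (hK : Measurable K)
    (hlaw : (ν.prod volume).map K = p.prod (Measure.pi fun _ : Fin d => ν))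
    {U : Finset (Word d)} (hU : IsRootedSubtree U)
    (A : Word d → Set Ω) (hA : ∀ i, MeasurableSet (A i))
    (B : Word d → Set I) (hB : ∀ i, MeasurableSet (B i))
    (C : Word d → Set unitInterval) (hC : ∀ i, MeasurableSet (C i))
    (J : Finset (Word d)) (hUJ : U ⊆ J) (hJ : ∀ i ∈ treeBoundary U, i ∈ J) :
    (ν.prod (Measure.infinitePi fun _ : Word d => (volume : Measure unitInterval)))
      (⋂ i ∈ J, exploredEvent K A B C U i) = ∏ i ∈ J, exploredWeight p ν A B C U i := by
  classical
  set P := ν.prod (Measure.infinitePi fun _ : Word d => (volume : Measure unitInterval)) with hP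
  revert A B C J
  refine IsRootedSubtree.induction ?_ ?_ U hU
  · intro A hA B hB C hC J _ hJ
    have h0 : [] ∈ J := hJ [] (mem_treeBoundary_empty.2 rfl)
    have h1 : (⋂ i ∈ J, exploredEvent K A B C ∅ i) = B [] ×ˢ (J : Set (Word d)).pi C := by
      ext s
      simp only [Set.mem_iInter, exploredEvent, Finset.notMem_empty, if_false,
        mem_treeBoundary_empty, Set.mem_prod, Set.mem_pi, Finset.mem_coe]
      constructor
      · intro h
        refine ⟨(by simpa [downwardState_nil] using h [] h0 : s.1 ∈ B [] ∧ _).1, fun i hi => ?_⟩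
        have := h i hi
        split_ifs at this
        · exact this.2
        · exact this
      · rintro ⟨h2, h3⟩ i hi
        split_ifs with h
        · subst h
          exact ⟨h2, h3 _ hi⟩
        · exact h3 _ hi
    have h2 : ∀ i, exploredWeight p ν A B C ∅ i
        = (if i = [] then ν (B []) else 1) * volume (C i) := by
      intro i
      simp only [exploredWeight, Finset.notMem_empty, if_false, mem_treeBoundary_empty]
      split_ifs with h
      · rw [h]
      · rw [one_mul]
    rw [h1, hP, Measure.prod_prod, Measure.infinitePi_pi _ (fun i _ => hC i)]
    simp only [h2, Finset.prod_mul_distrib, Finset.prod_ite_eq', h0, if_true]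
  · intro U v hU hv ih A hA B hB C hC J hUJ hJ
    have hvU := notMem_of_mem_treeBoundary hv
    have hvJ : v ∈ J := hUJ (Finset.mem_insert_self v U)
    have hbd := fun i => mem_treeBoundary_insert hU hv (i := i)
    have hcJ : ∀ k, v ++ [k] ∈ J := fun k => hJ _ ((hbd _).2 (Or.inr ⟨k, rfl⟩))
    set J₀ := J.erase v with hJ₀
    set R := ⋂ i ∈ J₀, exploredEvent K A B C U i with hR
    set Z : I × (Word d → unitInterval) → I × unitInterval :=
      fun s => (downwardState K v s, s.2 v) with hZ
    have hZm : Measurable Z :=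
      (measurable_downwardState hK v).prodMk ((measurable_pi_apply v).comp measurable_snd)
    have hRm : MeasurableSet R :=
      Finset.measurableSet_biInter _ fun i _ => measurableSet_exploredEvent hK hA hB hC U i
    -- The induction hypothesis holds for every choice of `B` and `C`. Varying them at `v` only,
    -- which does not affect `R`, determines the law of `Z` on the event `R`.
    have hrect : ∀ (B₀ : Set I) (C₀ : Set unitInterval), MeasurableSet B₀ → MeasurableSet C₀ →
        P (Z ⁻¹' (B₀ ×ˢ C₀) ∩ R)
          = (∏ i ∈ J₀, exploredWeight p ν A B C U i) * ν B₀ * volume C₀ := by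
      intro B₀ C₀ hB₀ hC₀
      have h1 := ih A hA (Function.update B v B₀)
        (fun i => by
          by_cases h : i = v
          · subst h; simpa using hB₀
          · simpa [h] using hB i)
        (Function.update C v C₀)
        (fun i => by
          by_cases h : i = v
          · subst h; simpa using hC₀
          · simpa [h] using hC i)
        J ((Finset.subset_insert v U).trans hUJ)
        (fun i hi => by
          by_cases h : i = v
          · exact h ▸ hvJ
          · exact hJ i ((hbd i).2 (Or.inl ⟨hi, h⟩)))
      rw [← Finset.mul_prod_erase J _ hvJ, ← Finset.insert_erase hvJ,
        Finset.set_biInter_insert, ← hJ₀, hJ₀, Finset.erase_insert (Finset.notMem_erase v J),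
        ← hJ₀] at h1
      have h2 : ∀ i ∈ J₀, exploredEvent K A (Function.update B v B₀) (Function.update C v C₀) U i
          = exploredEvent K A B C U i := fun i hi => by
        have : i ≠ v := Finset.ne_of_mem_erase hi
        simp [exploredEvent, this]
      have h3 : ∀ i ∈ J₀, exploredWeight p ν A (Function.update B v B₀) (Function.update C v C₀) U i
          = exploredWeight p ν A B C U i := fun i hi => by
        have : i ≠ v := Finset.ne_of_mem_erase hi
        simp [exploredWeight, this]
      rw [Set.iInter₂_congr h2, Finset.prod_congr rfl h3] at h1
      have h4 : exploredEvent K A (Function.update B v B₀) (Function.update C v C₀) U v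
          = Z ⁻¹' (B₀ ×ˢ C₀) := by
        simp only [exploredEvent, hvU, if_false, hv, if_true, Function.update_self]
        rfl
      rw [h4] at h1
      have h5 : exploredWeight p ν A (Function.update B v B₀) (Function.update C v C₀) U v
          = ν B₀ * volume C₀ := by
        simp [exploredWeight, hvU, hv]
      rw [hR, h1, h5]
      ring
    set c := ∏ i ∈ J₀, exploredWeight p ν A B C U i with hc
    have hjoint : (P.restrict R).map Z = c • ν.prod volume := by
      symm
      have hcfin : c ≠ ⊤ := by
        have := hrect Set.univ Set.univ MeasurableSet.univ MeasurableSet.univ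
        rw [measure_univ, measure_univ, mul_one, mul_one] at this
        rw [← this]
        exact measure_ne_top _ _
      have : IsFiniteMeasure (c • ν.prod (volume : Measure unitInterval)) :=
        Measure.smul_finite _ hcfin
      refine Measure.ext_prod fun {B₀ C₀} hB₀ hC₀ => ?_
      rw [Measure.map_apply hZm (hB₀.prod hC₀),
        Measure.restrict_apply (hZm (hB₀.prod hC₀)), hrect B₀ C₀ hB₀ hC₀, Measure.smul_apply,
        Measure.prod_prod, smul_eq_mul, mul_assoc]
    set D : Set (Ω × (Fin d → I)) := A v ×ˢ Set.univ.pi fun k => B (v ++ [k]) with hD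
    have hDm : MeasurableSet D := (hA v).prod (MeasurableSet.univ_pi fun k => hB _)
    -- Here the law of the sampler enters: `K` trades the state and the uniform variable at `v` for
    -- independent noise at `v` and states at its children.
    have hZD : P (Z ⁻¹' (K ⁻¹' D) ∩ R) = c * (p (A v) * ∏ k, ν (B (v ++ [k]))) := by
      rw [← Measure.restrict_apply (hZm (hK hDm)), ← Measure.map_apply hZm (hK hDm), hjoint,
        Measure.smul_apply, smul_eq_mul, ← Measure.map_apply hK hDm, hlaw, hD, Measure.prod_prod,
        Measure.pi_pi]
    have hev : (⋂ i ∈ J, exploredEvent K A B C (insert v U) i) = Z ⁻¹' (K ⁻¹' D) ∩ R := by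
      ext s
      simp only [Set.mem_iInter, hR, Set.mem_inter_iff, Set.mem_preimage, hD, Set.mem_prod,
        Set.mem_pi, Set.mem_univ, true_imp_iff]
      constructor
      · intro h
        refine ⟨⟨?_, fun k => ?_⟩, fun i hi => ?_⟩
        · have := h v hvJ
          simp only [exploredEvent, Finset.mem_insert_self, if_true] at this
          exact this
        · have := h _ (hcJ k)
          have h1 : v ++ [k] ∉ insert v U := by
            rw [Finset.mem_insert, not_or]
            exact ⟨by simp, append_singleton_notMem_of_mem_treeBoundary hU hv k⟩
          simp only [exploredEvent, h1, if_false, (hbd _).2 (Or.inr ⟨k, rfl⟩), if_true] at this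
          have h2 := this.1
          rwa [Set.mem_preimage, downwardState_append_singleton] at h2
        · have hiv : i ≠ v := Finset.ne_of_mem_erase hi
          have := h i (Finset.mem_of_mem_erase hi)
          simp only [exploredEvent, Finset.mem_insert, hiv, false_or, hbd, ne_eq,
            not_false_eq_true, and_true] at this ⊢
          by_cases h1 : i ∈ U
          · simpa [h1] using this
          · by_cases h2 : i ∈ treeBoundary U
            · simpa [h1, h2] using this
            · simp only [h1, h2, if_false, false_or] at this ⊢
              split_ifs at this
              · exact this.2
              · exact this
      · rintro ⟨⟨h1, h2⟩, h3⟩ i hi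
        by_cases hiv : i = v
        · subst hiv
          simp only [exploredEvent, Finset.mem_insert_self, if_true]
          exact h1
        · have := h3 i (Finset.mem_erase.2 ⟨hiv, hi⟩)
          simp only [exploredEvent, Finset.mem_insert, hiv, false_or, hbd, ne_eq,
            not_false_eq_true, and_true] at this ⊢
          by_cases h4 : i ∈ U
          · simpa [h4] using this
          · by_cases h5 : i ∈ treeBoundary U
            · simpa [h4, h5] using this
            · simp only [h4, h5, if_false, false_or] at this ⊢
              split_ifs with h6
              · obtain ⟨k, rfl⟩ := h6
                refine ⟨?_, this⟩
                rw [Set.mem_preimage, downwardState_append_singleton]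
                exact h2 k
              · exact this
    have hwt : (∏ i ∈ J, exploredWeight p ν A B C (insert v U) i)
        = c * (p (A v) * ∏ k, ν (B (v ++ [k]))) := by
      -- Away from `v` the weight changes only at the children of `v`. Their uniform variables are
      -- already accounted for before `v` is explored, so each child just gains the factor for its
      -- state.
      have h1 : ∀ i ∈ J₀, exploredWeight p ν A B C (insert v U) i
          = exploredWeight p ν A B C U i
            * if i ∈ Finset.univ.image (fun k => v ++ [k]) then ν (B i) else 1 := by
        intro i hi
        have hiv : i ≠ v := Finset.ne_of_mem_erase hi
        by_cases h6 : ∃ k, i = v ++ [k]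
        · obtain ⟨k, rfl⟩ := h6
          simp [exploredWeight, append_singleton_notMem_of_mem_treeBoundary hU hv k, hbd,
            append_singleton_notMem_treeBoundary hv k, mul_comm]
        · have h7 : i ∉ Finset.univ.image (fun k => v ++ [k]) := by
            simpa [eq_comm] using h6
          simp only [exploredWeight, Finset.mem_insert, hiv, false_or, hbd, ne_eq,
            not_false_eq_true, and_true, h6, or_false, h7, if_false, mul_one]
      rw [← Finset.mul_prod_erase J _ hvJ, ← hJ₀, Finset.prod_congr rfl h1,
        Finset.prod_mul_distrib, ← hc]
      have h2 : Finset.univ.image (fun k => v ++ [k]) ⊆ J₀ := by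
        intro i hi
        obtain ⟨k, -, rfl⟩ := Finset.mem_image.1 hi
        exact Finset.mem_erase.2 ⟨by simp, hcJ k⟩
      rw [Finset.prod_ite_mem, Finset.inter_eq_right.2 h2, Finset.prod_image
        (fun a _ b _ h => by simpa using h)]
      simp only [exploredWeight, Finset.mem_insert_self, if_true]
      ring
    rw [hev, hZD, hwt]

/-- If the law `ν` is invariant under the recursion then a recursive tree process exists. -/
theorem exists_isRTP {d : ℕ} {Ω I : Type} [MeasurableSpace Ω] [MeasurableSpace I]
    [StandardBorelSpace Ω] [StandardBorelSpace I] [Nonempty Ω] [Nonempty I]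
    {p : Measure Ω} [IsProbabilityMeasure p] {ν : Measure I} [IsProbabilityMeasure ν]
    {γ : Ω → (Fin d → I) → I} (hγ : Measurable (Function.uncurry γ))
    (hν : (p.prod (Measure.pi fun _ : Fin d => ν)).map (Function.uncurry γ) = ν) :
    ∃ (S : Type) (_ : MeasurableSpace S) (P : Measure S) (_ : IsProbabilityMeasure P)
      (ω : Word d → S → Ω) (X : Word d → S → I), IsRTP p γ ν P ω X := by
  classical
  obtain ⟨K, hK, hlaw, hrec⟩ := exists_backward_sampler hγ hν
  set P := ν.prod (Measure.infinitePi fun _ : Word d => (volume : Measure unitInterval)) with hP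
  have hbl : ∀ U, IsRootedSubtree U →
      HasBoundaryLaw p ν P (downwardNoise K) (downwardState K) U := by
    intro U hU A B hA hB
    have hdisj : Disjoint U (finite_treeBoundary U).toFinset := by
      rw [Finset.disjoint_left]
      intro i hi hi'
      exact notMem_of_mem_treeBoundary (by simpa using hi') hi
    have h := measure_iInter_exploredEvent hK hlaw hU A hA B hB (fun _ => Set.univ)
      (fun _ => MeasurableSet.univ) (U ∪ (finite_treeBoundary U).toFinset)
      Finset.subset_union_left (fun i hi => Finset.mem_union_right _ (by simpa using hi))
    rw [Finset.set_biInter_inter, Finset.prod_union hdisj] at h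
    have e1 : ∀ i ∈ U, exploredEvent K A B (fun _ => Set.univ) U i = downwardNoise K i ⁻¹' A i :=
      fun i hi => by simp [exploredEvent, hi]
    have e2 : ∀ i ∈ (finite_treeBoundary U).toFinset,
        exploredEvent K A B (fun _ => Set.univ) U i = downwardState K i ⁻¹' B i := by
      intro i hi
      rw [Set.Finite.mem_toFinset] at hi
      simp [exploredEvent, hi, notMem_of_mem_treeBoundary hi]
    have e3 : ∀ i ∈ U, exploredWeight p ν A B (fun _ => Set.univ) U i = p (A i) :=
      fun i hi => by simp [exploredWeight, hi]
    have e4 : ∀ i ∈ (finite_treeBoundary U).toFinset,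
        exploredWeight p ν A B (fun _ => Set.univ) U i = ν (B i) := by
      intro i hi
      rw [Set.Finite.mem_toFinset] at hi
      simp [exploredWeight, hi, notMem_of_mem_treeBoundary hi]
    rwa [Set.iInter₂_congr e1, Set.iInter₂_congr e2, Finset.prod_congr rfl e3,
      Finset.prod_congr rfl e4] at h
  refine ⟨_, inferInstance, P, inferInstance, downwardNoise K, downwardState K,
    IsRTP.of_hasBoundaryLaw (measurable_downwardNoise hK) (measurable_downwardState hK) hbl ?_⟩
  intro i
  set Z : I × (Word d → unitInterval) → I × unitInterval :=
    fun s => (downwardState K i s, s.2 i)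
  have hZm : Measurable Z :=
    (measurable_downwardState hK i).prodMk ((measurable_pi_apply i).comp measurable_snd)
  -- The words as long as `i` form the boundary of a ball, so the product formula applies with all
  -- constraints at other vertices trivial. The almost sure identity for the sampler can then be
  -- pulled back along `Z`.
  have hZ : P.map Z = ν.prod volume := by
    symm
    refine Measure.ext_prod fun {B₀ C₀} hB₀ hC₀ => ?_
    have hi : i ∈ treeBoundary (ball d i.length) := mem_treeBoundary_ball.2 rfl
    have hmem : ∀ j, j ∈ treeBoundary (ball d i.length) ↔ j.length = i.length :=
      fun j => mem_treeBoundary_ball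
    set J := ball d i.length ∪ (finite_treeBoundary (ball d i.length)).toFinset with hJ
    have hiJ : i ∈ J := Finset.mem_union_right _ (by simpa using hi)
    have h := measure_iInter_exploredEvent hK hlaw (isRootedSubtree_ball i.length)
      (fun _ => Set.univ) (fun _ => MeasurableSet.univ)
      (fun j => if j = i then B₀ else Set.univ)
      (fun j => by by_cases h : j = i <;> simp [h, hB₀])
      (fun j => if j = i then C₀ else Set.univ)
      (fun j => by by_cases h : j = i <;> simp [h, hC₀])
      J Finset.subset_union_left (fun i hi => Finset.mem_union_right _ (by simpa using hi))
    have hi' := notMem_of_mem_treeBoundary hi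
    rw [← Finset.mul_prod_erase J _ hiJ, Finset.prod_eq_one, mul_one] at h
    · have e : (⋂ j ∈ J, exploredEvent K (fun _ => Set.univ) (fun j => if j = i then B₀ else Set.univ)
          (fun j => if j = i then C₀ else Set.univ) (ball d i.length) j) = Z ⁻¹' (B₀ ×ˢ C₀) := by
        ext s
        simp only [Set.mem_iInter]
        constructor
        · intro h
          have := h i hiJ
          simp only [exploredEvent, hi', if_false, hi, if_true] at this
          exact this
        · intro h j _
          by_cases hj : j = i
          · subst hj
            simp only [exploredEvent, hi', if_false, hi, if_true]
            exact h
          · simp [exploredEvent, hj]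
      rw [e] at h
      rw [Measure.map_apply hZm (hB₀.prod hC₀), h, Measure.prod_prod]
      simp [exploredWeight, hi', hi]
    · intro j hj
      have hj := Finset.ne_of_mem_erase hj
      simp [exploredWeight, hj]
  have := (ae_map_iff hZm.aemeasurable (p := fun y => Function.uncurry γ (K y) = y.1)
    (measurableSet_eq_fun (hγ.comp hK) measurable_fst)).1 (hZ ▸ hrec)
  filter_upwards [this] with s hs
  simp only [downwardState_append_singleton]
  exact hs.symm

end Construction

/-! ### Uniqueness of the joint law of noise and root state. -/

section Uniqueness

variable {d : ℕ} {Ω I : Type*}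

/-- The states computed from the noise `t` and from the states `x` at `n` levels further down. -/
def treeEval (γ : Ω → (Fin d → I) → I) (t : Word d → Ω) (x : Word d → I) : ℕ → Word d → I
  | 0, i => x i
  | n + 1, i => γ (t i) fun k => treeEval γ t x n (i ++ [k])

open Classical in
/-- Extension of a partially defined family by a constant. -/
noncomputable def extendConst {α : Type*} [Nonempty α] (U : Set (Word d)) (t : U → α)
    (i : Word d) : α :=
  if h : i ∈ U then t ⟨i, h⟩ else Classical.arbitrary α

variable [MeasurableSpace Ω] [MeasurableSpace I]

lemma measurable_extendConst {α : Type*} [MeasurableSpace α] [Nonempty α] (U : Set (Word d)) :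
    Measurable (extendConst (α := α) U) := by
  refine measurable_pi_lambda _ fun i => ?_
  by_cases h : i ∈ U
  · simpa [extendConst, h] using measurable_pi_apply _
  · simp [extendConst, h]

lemma measurable_treeEval {γ : Ω → (Fin d → I) → I} (hγ : Measurable (Function.uncurry γ))
    (n : ℕ) (i : Word d) :
    Measurable fun y : (Word d → Ω) × (Word d → I) => treeEval γ y.1 y.2 n i := by
  induction n generalizing i with
  | zero => exact (measurable_pi_apply i).comp measurable_snd
  | succ n ih =>
    exact hγ.comp (((measurable_pi_apply i).comp measurable_fst).prodMk
      (measurable_pi_lambda _ fun k => ih _))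

namespace IsRTP

variable {S : Type*} [MeasurableSpace S] {p : Measure Ω} {γ : Ω → (Fin d → I) → I}
  {ν : Measure I} {P : Measure S} {ω : Word d → S → Ω}
  {X : Word d → S → I}

lemma map_noise_boundary [IsProbabilityMeasure P] (h : IsRTP p γ ν P ω X) (U : Finset (Word d)) (hU : IsRootedSubtree U)
    [Fintype (treeBoundary U)] :
    P.map (fun s => ((fun i : U => ω i s), fun i : treeBoundary U => X i s))
      = (Measure.pi fun _ : U => p).prod (Measure.pi fun _ : treeBoundary U => ν) := by
  have hω : Measurable fun s => fun i : U => ω i s :=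
    measurable_pi_lambda _ fun i => h.measurable_noise i
  have hX : Measurable fun s => fun i : treeBoundary U => X i s :=
    measurable_pi_lambda _ fun i => h.measurable_state i
  rw [(indepFun_iff_map_prod_eq_prod_map_map hω.aemeasurable hX.aemeasurable).1
    (h.indepFun_boundary_noise U hU).symm]
  congr 1
  · rw [(iIndepFun_iff_map_fun_eq_pi_map fun i : U => (h.measurable_noise i).aemeasurable).1
      (h.iIndepFun_noise.precomp Subtype.val_injective)]
    simp only [h.map_noise]
  · rw [(iIndepFun_iff_map_fun_eq_pi_map
      fun i : treeBoundary U => (h.measurable_state i).aemeasurable).1 (h.iIndepFun_boundary U hU)]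
    congr 1
    ext1 i
    exact h.map_boundary U hU i i.2

/-- Unfolding the recursion `n` times from the root reads the noise only at words shorter than `n`
and the states only at words of length `n`, so the default values of `extendConst` are never used.
-/
lemma ae_eq_treeEval [Nonempty Ω] [Nonempty I] (h : IsRTP p γ ν P ω X) (n : ℕ) :
    ∀ᵐ s ∂P, X [] s = treeEval γ (extendConst (ball d n) fun i => ω i s)
      (extendConst (treeBoundary (ball d n)) fun i => X i s) n [] := by
  filter_upwards [ae_all_iff.2 h.recursion] with s hs
  have key : ∀ m i, i.length + m = n →
      treeEval γ (extendConst (ball d n) fun i => ω i s)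
        (extendConst (treeBoundary (ball d n)) fun i => X i s) m i = X i s := by
    intro m
    induction m with
    | zero =>
      intro i hi
      have : i ∈ treeBoundary (ball d n) := mem_treeBoundary_ball.2 (by omega)
      simp [treeEval, extendConst, this]
    | succ m ih =>
      intro i hi
      have : i ∈ (ball d n : Set (Word d)) := mem_ball.2 (by omega)
      rw [hs i]
      simp only [treeEval, extendConst, this, dite_true]
      congr 1
      ext1 k
      exact ih _ (by rw [List.length_append]; simp; omega)
  exact (key n [] (by simp)).symm

/-- The joint law of the noise and the state at the root is the same for all recursive tree
processes with the same characteristics. -/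
lemma measure_noise_root_eq [IsProbabilityMeasure P] [Nonempty Ω] [Nonempty I] {S' : Type*} [MeasurableSpace S']
    {P' : Measure S'} [IsProbabilityMeasure P'] {ω' : Word d → S' → Ω} {X' : Word d → S' → I}
    (hγ : Measurable (Function.uncurry γ))
    (h : IsRTP p γ ν P ω X) (h' : IsRTP p γ ν P' ω' X') {D : Set (Word d → Ω)}
    (hD : MeasurableSet D) {B : Set I} (hB : MeasurableSet B) :
    P ((fun s i => ω i s) ⁻¹' D ∩ X [] ⁻¹' B) = P' ((fun s i => ω' i s) ⁻¹' D ∩ X' [] ⁻¹' B) := by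
  have hω : Measurable fun s i => ω i s := measurable_pi_lambda _ h.measurable_noise
  have hω' : Measurable fun s i => ω' i s := measurable_pi_lambda _ h'.measurable_noise
  have hn : ∀ n, P.map (fun s => ((fun i : ball d n => ω i s), X [] s))
      = P'.map (fun s => ((fun i : ball d n => ω' i s), X' [] s)) := by
    intro n
    have : Fintype (treeBoundary (ball d n)) := (finite_treeBoundary _).fintype
    set Φ : (ball d n → Ω) × (treeBoundary (ball d n) → I) → (ball d n → Ω) × I :=
      fun y => (y.1, treeEval γ (extendConst (ball d n) y.1) (extendConst _ y.2) n []) with hΦ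
    have hΦm : Measurable Φ := measurable_fst.prodMk ((measurable_treeEval hγ n []).comp
      (((measurable_extendConst _).comp measurable_fst).prodMk
        ((measurable_extendConst _).comp measurable_snd)))
    have e1 : (fun s => ((fun i : ball d n => ω i s), X [] s)) =ᵐ[P]
        Φ ∘ fun s => ((fun i : ball d n => ω i s), fun i : treeBoundary (ball d n) => X i s) := by
      filter_upwards [h.ae_eq_treeEval n] with s hs
      rw [hs]
      rfl
    have e2 : (fun s => ((fun i : ball d n => ω' i s), X' [] s)) =ᵐ[P']
        Φ ∘ fun s => ((fun i : ball d n => ω' i s), fun i : treeBoundary (ball d n) => X' i s) := by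
      filter_upwards [h'.ae_eq_treeEval n] with s hs
      rw [hs]
      rfl
    rw [Measure.map_congr e1, Measure.map_congr e2, ← Measure.map_map hΦm, ← Measure.map_map hΦm,
      h.map_noise_boundary _ (isRootedSubtree_ball n),
      h'.map_noise_boundary _ (isRootedSubtree_ball n)]
    · exact (measurable_pi_lambda _ fun i : ball d n => h'.measurable_noise i).prodMk
        (measurable_pi_lambda _ fun i : treeBoundary (ball d n) => h'.measurable_state i)
    · exact (measurable_pi_lambda _ fun i : ball d n => h.measurable_noise i).prodMk
        (measurable_pi_lambda _ fun i : treeBoundary (ball d n) => h.measurable_state i)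
  -- Agreement on all balls passes to the whole noise, because a finite measure on a product is
  -- determined by its finite-dimensional marginals.
  have hlim : (P.restrict (X [] ⁻¹' B)).map (fun s i => ω i s)
      = (P'.restrict (X' [] ⁻¹' B)).map (fun s i => ω' i s) := by
    refine IsProjectiveLimit.unique (P := fun J : Finset (Word d) =>
      ((P'.restrict (X' [] ⁻¹' B)).map (fun s i => ω' i s)).map J.restrict) (fun J => ?_)
      (fun J => rfl)
    ext E hE
    obtain ⟨n, hJn⟩ := exists_subset_ball J
    have hset : MeasurableSet ((Finset.restrict₂ (π := fun _ => Ω) hJn ⁻¹' E) ×ˢ B) :=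
      (Finset.measurable_restrict₂ hJn hE).prod hB
    have e := congrArg (fun m => m ((Finset.restrict₂ (π := fun _ => Ω) hJn ⁻¹' E) ×ˢ B)) (hn n)
    beta_reduce at e
    rw [Measure.map_apply ((measurable_pi_lambda _ fun i : ball d n => h.measurable_noise i).prodMk
        (h.measurable_state [])) hset,
      Measure.map_apply ((measurable_pi_lambda _ fun i : ball d n => h'.measurable_noise i).prodMk
        (h'.measurable_state [])) hset] at e
    have hE' := Finset.measurable_restrict (X := fun _ => Ω) J hE
    rw [Measure.map_apply (Finset.measurable_restrict J) hE,
      Measure.map_apply (Finset.measurable_restrict J) hE, Measure.map_apply hω hE',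
      Measure.map_apply hω' hE', Measure.restrict_apply (hω hE'),
      Measure.restrict_apply (hω' hE')]
    exact e
  rw [← Measure.restrict_apply (hω hD), ← Measure.restrict_apply (hω' hD),
    ← Measure.map_apply hω hD, ← Measure.map_apply hω' hD, hlim]

/-- If a recursive tree process is endogenous then in each recursive tree process that carries a
second family of states for the same noise, both states at the root agree. -/
lemma measure_root_ne_eq_zero [IsProbabilityMeasure P] [Nonempty Ω] [Nonempty I] {S' : Type*} [MeasurableSpace S']
    {P' : Measure S'} [IsProbabilityMeasure P'] {ω' : Word d → S' → Ω} {X' Y' : Word d → S' → I}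
    (hγ : Measurable (Function.uncurry γ)) (h : IsRTP p γ ν P ω X) (hend : IsEndogenous P ω X)
    (hX' : IsRTP p γ ν P' ω' X') (hY' : IsRTP p γ ν P' ω' Y') {B : Set I} (hB : MeasurableSet B) :
    P' (X' [] ⁻¹' B ∩ Y' [] ⁻¹' Bᶜ) = 0 := by
  obtain ⟨Y, hY, hXY⟩ := hend
  have hσ : (⨆ i : Word d, MeasurableSpace.comap (ω i) inferInstance)
      = MeasurableSpace.comap (fun s i => ω i s) MeasurableSpace.pi := by
    simp only [MeasurableSpace.pi, MeasurableSpace.comap_iSup, MeasurableSpace.comap_comp]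
    rfl
  -- Endogeny turns the root event into a noise event `D`. By uniqueness of the joint law, the same
  -- `D` describes the root event for `X'` and for `Y'`.
  obtain ⟨D, hD, hDB⟩ : MeasurableSet[MeasurableSpace.comap (fun s i => ω i s)
      MeasurableSpace.pi] (Y ⁻¹' B) := hσ ▸ hY hB
  have hae : ∀ᵐ s ∂P, (fun i => ω i s) ∈ D ↔ X [] s ∈ B := by
    filter_upwards [hXY] with s hs
    rw [hs]
    exact Set.ext_iff.1 hDB s
  have h1 : P' ((fun s i => ω' i s) ⁻¹' Dᶜ ∩ X' [] ⁻¹' B) = 0 := by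
    rw [← measure_noise_root_eq hγ h hX' hD.compl hB]
    refine measure_mono_null (fun s hs => ?_) (ae_iff.1 hae)
    exact fun hs' => hs.1 (hs'.2 hs.2)
  have h2 : P' ((fun s i => ω' i s) ⁻¹' D ∩ Y' [] ⁻¹' Bᶜ) = 0 := by
    rw [← measure_noise_root_eq hγ h hY' hD hB.compl]
    refine measure_mono_null (fun s hs => ?_) (ae_iff.1 hae)
    exact fun hs' => hs.2 (hs'.1 hs.1)
  refine measure_mono_null (fun s hs => ?_) (measure_union_null h1 h2)
  by_cases hsD : (fun i => ω' i s) ∈ D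
  · exact Or.inr ⟨hsD, hs.2⟩
  · exact Or.inl ⟨hsD, hs.1⟩

/-- A measurable map of the state spaces that intertwines the recursions maps recursive tree
processes to recursive tree processes. -/
lemma map_state {I' : Type*} [MeasurableSpace I'] {γ' : Ω → (Fin d → I') → I'} {ν' : Measure I'}
    (h : IsRTP p γ ν P ω X) {f : I → I'} (hf : Measurable f) (hν : ν.map f = ν')
    (hγ : ∀ t x, f (γ t x) = γ' t fun k => f (x k)) :
    IsRTP p γ' ν' P ω (fun i s => f (X i s)) where
  measurable_noise := h.measurable_noise
  measurable_state i := hf.comp (h.measurable_state i)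
  iIndepFun_noise := h.iIndepFun_noise
  map_noise := h.map_noise
  iIndepFun_boundary U hU := (h.iIndepFun_boundary U hU).comp (fun _ => f) fun _ => hf
  map_boundary U hU i hi := by
    rw [← hν, ← h.map_boundary U hU i hi, Measure.map_map hf (h.measurable_state i)]
    rfl
  indepFun_boundary_noise U hU := (h.indepFun_boundary_noise U hU).comp
    (φ := fun x : treeBoundary U → I => fun i => f (x i)) (ψ := id)
    (measurable_pi_lambda _ fun i => hf.comp (measurable_pi_apply i)) measurable_id
  recursion i := by
    filter_upwards [h.recursion i] with s hs
    rw [hs, hγ]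

end IsRTP

end Uniqueness

/-! ### The scaling profile -/

/-- A scaling profile: `b * w (a / b)` is the mass that the scale invariant coupling constructed
below gives to `(a, ∞) × (0, b]`. -/
structure IsProfile (k z : ℝ) (w : ℝ → ℝ) : Prop where
  k_pos : 0 < k
  z_pos : 0 < z
  z_le_one : z ≤ 1
  two_mul_k : 2 * k = z * (z + 1)
  at_zero : w 0 = 1
  at_one : w 1 = z
  pos : ∀ x, 0 < w x
  hasDerivAt : ∀ x, HasDerivAt w (k * x / w x - 1) x
  monotone_div : Monotone fun x => x / w x

/-- For `k = r * (r + 1)` the solutions of `g'' + g' = k * g` are spanned by `exp (r * s)` and `exp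
(-(1 + r) * s)`. If `g 0 = 0` and `g' 0 = 1`, then `g σ = 1` and `g' σ = z` amount to the two
exponential identities. Since `(z + 1 + r) * (z - r) = r * (r + 1)`, eliminating `σ` leaves `log (z
+ 1 + r) + r * log (r * (r + 1)) = 0`, with `z` the positive root `Z r` of the quadratic equation.
-/
lemma exists_profile_parameters : ∃ r z σ : ℝ, 0 < r ∧ 0 < z ∧ z ≤ 1 ∧
    z * (z + 1) = 2 * (r * (r + 1)) ∧ Real.exp (r * σ) = z + 1 + r ∧
    Real.exp (-(1 + r) * σ) = z - r := by
  set Z : ℝ → ℝ := fun r => (-1 + √(1 + 8 * (r * (r + 1)))) / 2 with hZ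
  have hZc : Continuous Z := by fun_prop
  set f : ℝ → ℝ := fun r => Real.log (Z r + 1 + r) + r * Real.log (r * (r + 1)) with hf
  have hZpos : ∀ r, 0 < r → 0 < Z r := by
    intro r hr
    have : 1 < √(1 + 8 * (r * (r + 1))) := by
      rw [Real.lt_sqrt (by norm_num)]
      nlinarith [mul_pos hr hr]
    simp only [hZ]
    linarith
  -- At a small `r` the first summand of `f` is at most `3 * r`, by `Z r ≤ 2 * r`, while the second
  -- is at most `r * (log r + r)`. With `log r = -4` the sum is at most `r * (r - 1) ≤ 0`.
  set e := Real.exp (-4) with he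
  have he0 : 0 < e := Real.exp_pos _
  have he1 : e ≤ 1 := by rw [he, Real.exp_le_one_iff]; norm_num
  have hfc : ContinuousOn f (Set.Icc e 1) := by
    have h1 : ∀ r ∈ Set.Icc e 1, Z r + 1 + r ≠ 0 := fun r hr => by
      have h0 := he0.trans_le hr.1
      have := hZpos r h0
      positivity
    have h2 : ∀ r ∈ Set.Icc e 1, r * (r + 1) ≠ 0 := fun r hr => by
      have : 0 < r := he0.trans_le hr.1
      positivity
    exact ((by fun_prop : ContinuousOn (fun r => Z r + 1 + r) _).log h1).add
      (continuousOn_id.mul ((by fun_prop : ContinuousOn (fun r : ℝ => r * (r + 1)) _).log h2))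
  have hfe : f e ≤ 0 := by
    have h1 : Z e ≤ 2 * e := by
      have : √(1 + 8 * (e * (e + 1))) ≤ 1 + 4 * e := by
        rw [Real.sqrt_le_left (by positivity)]
        nlinarith [mul_pos he0 he0]
      simp only [hZ]
      linarith
    have h2 : Real.log (Z e + 1 + e) ≤ Z e + 1 + e - 1 :=
      Real.log_le_sub_one_of_pos (by have := hZpos e he0; positivity)
    have h3 : Real.log (e * (e + 1)) ≤ -4 + e := by
      rw [Real.log_mul he0.ne' (by positivity), he, Real.log_exp]
      have := Real.log_le_sub_one_of_pos (x := Real.exp (-4) + 1) (by positivity)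
      linarith
    have h4 : e * Real.log (e * (e + 1)) ≤ e * (-4 + e) := mul_le_mul_of_nonneg_left h3 he0.le
    simp only [hf]
    nlinarith
  have hf1 : 0 ≤ f 1 := by
    have h1 := hZpos 1 one_pos
    have h2 : 0 ≤ Real.log (Z 1 + 1 + 1) := Real.log_nonneg (by linarith)
    have h3 : 0 ≤ Real.log (1 * (1 + 1)) := Real.log_nonneg (by norm_num)
    simp only [hf]
    linarith
  obtain ⟨r, hr, hfr⟩ := intermediate_value_Icc he1 hfc ⟨hfe, hf1⟩
  have hr0 : 0 < r := he0.trans_le hr.1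
  have hz0 := hZpos r hr0
  have hzz : Z r * (Z r + 1) = 2 * (r * (r + 1)) := by
    have := Real.sq_sqrt (show 0 ≤ 1 + 8 * (r * (r + 1)) by positivity)
    simp only [hZ]
    nlinarith
  set z := Z r
  have hlog : Real.log (z + 1 + r) = -(r * Real.log (r * (r + 1))) := by
    have : Real.log (z + 1 + r) + r * Real.log (r * (r + 1)) = 0 := hfr
    linarith
  have hpos : 0 < z + 1 + r := by positivity
  refine ⟨r, z, Real.log (z + 1 + r) / r, hr0, hz0, ?_, hzz, ?_, ?_⟩
  -- If `z > 1` then `r * (r + 1) ≥ 1`, and `f r` would be strictly positive.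
  · by_contra! h
    have h1 : 1 ≤ r * (r + 1) := by nlinarith
    have h2 := Real.log_nonneg h1
    have h3 : 0 < Real.log (z + 1 + r) := Real.log_pos (by linarith)
    nlinarith [mul_nonneg hr0.le h2]
  · rw [mul_div_cancel₀ _ hr0.ne', Real.exp_log hpos]
  · have h1 : -(1 + r) * (Real.log (z + 1 + r) / r)
        = Real.log (r * (r + 1)) - Real.log (z + 1 + r) := by
      have : Real.log (z + 1 + r) / r = -Real.log (r * (r + 1)) := by
        rw [hlog]; field_simp
      have h3 : r * (Real.log (z + 1 + r) / r) = Real.log (z + 1 + r) :=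
        mul_div_cancel₀ _ hr0.ne'
      linarith
    rw [h1, Real.exp_sub, Real.exp_log (by positivity), Real.exp_log hpos, div_eq_iff hpos.ne']
    linarith

/-- With `x = g s` and `w x = g' s`, the slope of `w` is `g'' / g' = k * g / g' - 1`. As `g` is an
increasing bijection of the line, `w` is defined and positive everywhere. -/
lemma exists_isProfile : ∃ (k z : ℝ) (w : ℝ → ℝ), IsProfile k z w := by
  obtain ⟨r, z, σ, hr, hz0, hz1, hzr, h1, h2⟩ := exists_profile_parameters
  set E : ℝ → ℝ := fun s => Real.exp (r * s) with hE
  set F : ℝ → ℝ := fun s => Real.exp (-(1 + r) * s) with hF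
  have hE0 : ∀ s, 0 < E s := fun s => Real.exp_pos _
  have hF0 : ∀ s, 0 < F s := fun s => Real.exp_pos _
  have hEd : ∀ s, HasDerivAt E (r * E s) s := fun s => by
    have := ((hasDerivAt_id s).const_mul r).exp
    simpa [hE, mul_comm] using this
  have hFd : ∀ s, HasDerivAt F (-(1 + r) * F s) s := fun s => by
    have := ((hasDerivAt_id s).const_mul (-(1 + r))).exp
    simpa only [hF, id, mul_one, mul_comm (Real.exp _)] using this
  set g : ℝ → ℝ := fun s => (E s - F s) / (1 + 2 * r) with hg
  set g' : ℝ → ℝ := fun s => (r * E s + (1 + r) * F s) / (1 + 2 * r) with hg'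
  have hD : 0 < 1 + 2 * r := by positivity
  have hg'0 : ∀ s, 0 < g' s := fun s => by have := hE0 s; have := hF0 s; positivity
  have hgd : ∀ s, HasDerivAt g (g' s) s := fun s => by
    refine (((hEd s).sub (hFd s)).div_const (1 + 2 * r)).congr_deriv ?_
    simp only [hg']
    ring
  set k := r * (1 + r) with hk
  have hg'd : ∀ s, HasDerivAt g' (k * g s - g' s) s := fun s => by
    refine ((((hEd s).const_mul r).add ((hFd s).const_mul (1 + r))).div_const
      (1 + 2 * r)).congr_deriv ?_
    simp only [hg, hg', hk]
    ring
  have hmono : StrictMono g := strictMono_of_deriv_pos fun s => by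
    rw [(hgd s).deriv]; exact hg'0 s
  have hgc : Continuous g := continuous_iff_continuousAt.2 fun s => (hgd s).continuousAt
  have hsurj : Function.Surjective g := by
    have hEt : Filter.Tendsto E Filter.atTop Filter.atTop :=
      Real.tendsto_exp_atTop.comp (Filter.tendsto_id.const_mul_atTop hr)
    have hFt : Filter.Tendsto F Filter.atBot Filter.atTop :=
      Real.tendsto_exp_atTop.comp
        (Filter.tendsto_id.const_mul_atBot_of_neg (by linarith : -(1 + r) < 0))
    refine hgc.surjective ?_ ?_
    · refine Filter.Tendsto.atTop_div_const hD ?_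
      refine Filter.tendsto_atTop_mono' _ ?_ (Filter.tendsto_atTop_add_const_right _ (-1) hEt)
      filter_upwards [Filter.eventually_ge_atTop 0] with s hs
      have : F s ≤ 1 := Real.exp_le_one_iff.2 (by nlinarith)
      linarith
    · refine Filter.Tendsto.atBot_div_const hD ?_
      refine Filter.tendsto_atBot_mono' _ ?_
        (Filter.tendsto_atBot_add_const_left _ 1 (Filter.tendsto_neg_atTop_atBot.comp hFt))
      filter_upwards [Filter.eventually_le_atBot 0] with s hs
      have : E s ≤ 1 := Real.exp_le_one_iff.2 (by nlinarith)
      simp only [Function.comp]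
      linarith
  set o := hmono.orderIsoOfSurjective g hsurj with ho
  have hgo : ∀ x, g (o.symm x) = x := fun x => o.apply_symm_apply x
  have hog : ∀ s, o.symm (g s) = s := fun s => o.symm_apply_apply s
  have hod : ∀ x, HasDerivAt o.symm (g' (o.symm x))⁻¹ x := fun x =>
    HasDerivAt.of_local_left_inverse (f := g) o.symm.continuous.continuousAt (hgd _)
      (hg'0 _).ne' (Filter.Eventually.of_forall hgo)
  have hg0 : g 0 = 0 := by simp [hg, hE, hF]
  have hg'0' : g' 0 = 1 := by
    simp only [hg', hE, hF, mul_zero, Real.exp_zero]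
    field_simp
    ring
  have hgσ : g σ = 1 := by
    simp only [hg, hE, hF, h1, h2]
    field_simp
    ring
  have hg'σ : g' σ = z := by
    simp only [hg', hE, hF, h1, h2]
    field_simp
    ring
  have hwd : ∀ x, HasDerivAt (fun x => g' (o.symm x)) (k * x / g' (o.symm x) - 1) x := fun x => by
    refine ((hg'd (o.symm x)).comp x (hod x)).congr_deriv ?_
    rw [hgo]
    have := (hg'0 (o.symm x)).ne'
    field_simp
  refine ⟨k, z, fun x => g' (o.symm x), by positivity, hz0, hz1, ?_, ?_, ?_, fun x => hg'0 _, hwd, ?_⟩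
  · rw [hzr, hk]; ring
  · rw [← hg0, hog, hg'0']
  · rw [← hgσ, hog, hg'σ]
  · have hd : ∀ x, HasDerivAt (fun x => x / g' (o.symm x))
        ((1 * g' (o.symm x) - x * (k * x / g' (o.symm x) - 1)) / g' (o.symm x) ^ 2) x :=
      fun x => (hasDerivAt_id x).div (hwd x) (hg'0 _).ne'
    refine monotone_of_deriv_nonneg (fun x => (hd x).differentiableAt) fun x => ?_
    rw [(hd x).deriv]
    refine div_nonneg ?_ (sq_nonneg _)
    set s := o.symm x
    have hx : x = g s := (hgo x).symm
    -- The two factors are the two exponentials, which gives the sign of the derivative of `x / w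
    -- x`.
    have h3 : 1 * g' s - x * (k * x / g' s - 1) = (g' s - r * x) * (g' s + (1 + r) * x) / g' s := by
      have := (hg'0 s).ne'
      rw [hk]
      field_simp
      ring
    have h4 : g' s - r * x = F s := by
      rw [hx]; simp only [hg, hg']; field_simp; ring
    have h5 : g' s + (1 + r) * x = E s := by
      rw [hx]; simp only [hg, hg']; field_simp; ring
    rw [h3, h4, h5]
    exact div_nonneg (mul_nonneg (hF0 s).le (hE0 s).le) (hg'0 s).le

/-! ### A coupling of the law of burning times with itself -/

namespace IsProfile

variable {k z : ℝ} {w : ℝ → ℝ}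

lemma continuous (hw : IsProfile k z w) : Continuous w :=
  continuous_iff_continuousAt.2 fun x => (hw.hasDerivAt x).continuousAt

lemma k_div_z (hw : IsProfile k z w) : k / z = (z + 1) / 2 := by
  rw [div_eq_div_iff hw.z_pos.ne' two_ne_zero]
  linarith [hw.two_mul_k]

lemma continuous_div (hw : IsProfile k z w) : Continuous fun x => k * (x / w x) :=
  continuous_const.mul (continuous_id.div hw.continuous fun x => (hw.pos x).ne')

/-- The distribution function of the ratio of the smaller and the larger coordinate. -/
noncomputable def stieltjes (hw : IsProfile k z w) : StieltjesFunction ℝ where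
  toFun x := k * (x / w x)
  mono' := hw.monotone_div.const_mul hw.k_pos.le
  right_continuous' _ := hw.continuous_div.continuousWithinAt

/-- The law of the ratio of the smaller and the larger coordinate. -/
noncomputable def ratioLaw (hw : IsProfile k z w) : Measure ℝ :=
  hw.stieltjes.measure.restrict (Set.Ioc 0 1)

lemma ratioLaw_univ (hw : IsProfile k z w) : hw.ratioLaw Set.univ = ENNReal.ofReal ((z + 1) / 2) := by
  rw [ratioLaw, Measure.restrict_apply_univ, StieltjesFunction.measure_Ioc]
  simp [stieltjes, hw.at_one, ← hw.k_div_z, div_eq_mul_inv]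

instance (hw : IsProfile k z w) : IsFiniteMeasure hw.ratioLaw :=
  ⟨by rw [ratioLaw_univ]; exact ENNReal.ofReal_lt_top⟩

lemma ratioLaw_Ici (hw : IsProfile k z w) {x : ℝ} (hx : 0 < x) :
    hw.ratioLaw (Set.Ici x) = ENNReal.ofReal ((z + 1) / 2 - k * (x / w x)) := by
  have h1 : Set.Ici x ∩ Set.Ioc 0 1 = Set.Icc x 1 := by
    ext y
    simp only [Set.mem_inter_iff, Set.mem_Ici, Set.mem_Ioc, Set.mem_Icc]
    exact ⟨fun h => ⟨h.1, h.2.2⟩, fun h => ⟨h.1, hx.trans_le h.1, h.2⟩⟩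
  have h2 : Function.leftLim hw.stieltjes x = hw.stieltjes x :=
    hw.continuous_div.continuousWithinAt.leftLim_eq
  rw [ratioLaw, Measure.restrict_apply measurableSet_Ici, h1, StieltjesFunction.measure_Icc, h2]
  simp [stieltjes, hw.at_one, ← hw.k_div_z, div_eq_mul_inv]

/-- The joint law of the smaller coordinate and the ratio of both coordinates. -/
noncomputable def intensity (hw : IsProfile k z w) : Measure (ℝ × ℝ) :=
  (volume.restrict (Set.Ioc 0 (1 / 2))).prod hw.ratioLaw

instance (hw : IsProfile k z w) : IsFiniteMeasure hw.intensity := by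
  unfold intensity; infer_instance

lemma ae_intensity (hw : IsProfile k z w) :
    ∀ᵐ y ∂hw.intensity, (0 < y.1 ∧ y.1 ≤ 1 / 2) ∧ (0 < y.2 ∧ y.2 ≤ 1) := by
  have h1 : ∀ᵐ a ∂(volume.restrict (Set.Ioc (0 : ℝ) (1 / 2))), 0 < a ∧ a ≤ 1 / 2 :=
    ae_restrict_mem measurableSet_Ioc
  have h2 : ∀ᵐ x ∂hw.ratioLaw, 0 < x ∧ x ≤ 1 := ae_restrict_mem measurableSet_Ioc
  have h3 := Measure.quasiMeasurePreserving_fst (μ := volume.restrict (Set.Ioc (0 : ℝ) (1 / 2)))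
    (ν := hw.ratioLaw) |>.ae h1
  have h4 := Measure.quasiMeasurePreserving_snd (μ := volume.restrict (Set.Ioc (0 : ℝ) (1 / 2)))
    (ν := hw.ratioLaw) |>.ae h2
  exact h3.and h4

lemma measureReal_intensity_fst_le (hw : IsProfile k z w) {a : ℝ} (ha : 0 ≤ a) (ha' : a ≤ 1 / 2) :
    hw.intensity.real {y | y.1 ≤ a} = a * ((z + 1) / 2) := by
  have h1 : {y : ℝ × ℝ | y.1 ≤ a} = Set.Iic a ×ˢ Set.univ := by ext; simp
  have h2 : Set.Iic a ∩ Set.Ioc 0 (1 / 2) = Set.Ioc 0 a := by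
    ext y
    simp only [Set.mem_inter_iff, Set.mem_Iic, Set.mem_Ioc]
    exact ⟨fun h => ⟨h.2.1, h.1⟩, fun h => ⟨h.2, h.1, h.2.trans ha'⟩⟩
  have := hw.z_pos
  rw [h1, intensity, Measure.real, Measure.prod_prod, ratioLaw_univ,
    Measure.restrict_apply measurableSet_Iic, h2, Real.volume_Ioc, sub_zero,
    ← ENNReal.ofReal_mul ha, ENNReal.toReal_ofReal (by positivity)]

lemma measureReal_intensity_univ (hw : IsProfile k z w) :
    hw.intensity.real Set.univ = (z + 1) / 4 := by
  have h := hw.measureReal_intensity_fst_le (a := 1 / 2) (by norm_num) le_rfl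
  rw [← measureReal_congr (s := {y | y.1 ≤ 1 / 2}) (t := Set.univ)]
  · rw [h]; ring
  · refine Filter.eventuallyEq_univ.2 ?_
    filter_upwards [hw.ae_intensity] with y hy using hy.1.2

lemma hasDerivAt_scale (hw : IsProfile k z w) {b : ℝ} (hb : 0 < b) (a : ℝ) :
    HasDerivAt (fun a => b * w (a / b)) (k * ((a / b) / w (a / b)) - 1) a := by
  have h1 : HasDerivAt (fun a => a / b) (1 / b) a := (hasDerivAt_id a).div_const b
  refine (((hw.hasDerivAt (a / b)).comp a h1).const_mul b).congr_deriv ?_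
  have := (hw.pos (a / b)).ne'
  field_simp

/-- When the smaller coordinate is `c`, the larger one is at most `b` if and only if the ratio is at
least `c / b`. By the differential equation this slice has mass `(z - 1) / 2 - w' (c / b)`, which
has an explicit primitive in `c`. -/
lemma measureReal_intensity_le_le (hw : IsProfile k z w) {a b : ℝ} (ha : 0 ≤ a) (hab : a ≤ b)
    (ha' : a ≤ 1 / 2) :
    hw.intensity.real {y | y.1 ≤ a ∧ y.1 / y.2 ≤ b} = a * (z - 1) / 2 + b - b * w (a / b) := by
  rcases ha.eq_or_lt with rfl | ha0
  · have h0 : hw.intensity {y : ℝ × ℝ | y.1 ≤ 0 ∧ y.1 / y.2 ≤ b} = 0 := by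
      refine measure_mono_null (fun y hy => ?_) (ae_iff.1 hw.ae_intensity)
      exact fun h => absurd hy.1 (not_le.2 h.1.1)
    simp [Measure.real, h0, hw.at_zero]
  have hb : 0 < b := ha0.trans_le hab
  have hm : MeasurableSet {y : ℝ × ℝ | y.1 ≤ a ∧ y.1 / y.2 ≤ b} :=
    (measurableSet_le measurable_fst measurable_const).inter
      (measurableSet_le (measurable_fst.div measurable_snd) measurable_const)
  have hslice : ∀ c ∈ Set.Ioc (0 : ℝ) (1 / 2),
      hw.ratioLaw (Prod.mk c ⁻¹' {y : ℝ × ℝ | y.1 ≤ a ∧ y.1 / y.2 ≤ b})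
        = (Set.Ioc 0 a).indicator
          (fun c => ENNReal.ofReal ((z + 1) / 2 - k * ((c / b) / w (c / b)))) c := by
    intro c hc
    by_cases hca : c ≤ a
    · rw [Set.indicator_of_mem (show c ∈ Set.Ioc 0 a from ⟨hc.1, hca⟩),
        ← hw.ratioLaw_Ici (div_pos hc.1 hb)]
      refine measure_congr ?_
      have h2 : ∀ᵐ x ∂hw.ratioLaw, 0 < x ∧ x ≤ 1 := ae_restrict_mem measurableSet_Ioc
      filter_upwards [h2] with x hx
      refine propext ⟨fun h => ?_, fun h => ⟨hca, ?_⟩⟩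
      · have h3 : c / x ≤ b := h.2
        rw [div_le_iff₀ hx.1] at h3
        exact (div_le_iff₀' hb).2 h3
      · have h3 : c / b ≤ x := h
        rw [div_le_iff₀' hb] at h3
        exact (div_le_iff₀ hx.1).2 h3
    · rw [Set.indicator_of_notMem (fun h => hca h.2)]
      convert measure_empty (μ := hw.ratioLaw)
      ext x
      simp [hca]
  have hcont : Continuous fun c => (z + 1) / 2 - k * ((c / b) / w (c / b)) :=
    continuous_const.sub (hw.continuous_div.comp (continuous_id.div_const b))
  have hnonneg : ∀ c ∈ Set.Ioc (0 : ℝ) a, 0 ≤ (z + 1) / 2 - k * ((c / b) / w (c / b)) := by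
    intro c hc
    have h1 : c / b ≤ 1 := (div_le_one hb).2 (hc.2.trans hab)
    have h2 : (c / b) / w (c / b) ≤ 1 / w 1 := hw.monotone_div h1
    have h3 := mul_le_mul_of_nonneg_left h2 hw.k_pos.le
    rw [hw.at_one, mul_one_div, hw.k_div_z] at h3
    linarith
  have hae : 0 ≤ᵐ[volume.restrict (Set.Ioc 0 a)]
      fun c => (z + 1) / 2 - k * ((c / b) / w (c / b)) := by
    filter_upwards [ae_restrict_mem measurableSet_Ioc] with c hc using hnonneg c hc
  have hint : ∫ c in (0 : ℝ)..a, ((z + 1) / 2 - k * ((c / b) / w (c / b)))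
      = a * (z - 1) / 2 + b - b * w (a / b) := by
    have hd : ∀ c ∈ Set.uIcc 0 a, HasDerivAt (fun c => c * (z - 1) / 2 - b * w (c / b))
        ((z + 1) / 2 - k * ((c / b) / w (c / b))) c := fun c _ => by
      refine ((((hasDerivAt_id c).mul_const (z - 1)).div_const 2).sub
        (hw.hasDerivAt_scale hb c)).congr_deriv ?_
      ring
    rw [intervalIntegral.integral_eq_sub_of_hasDerivAt hd (hcont.intervalIntegrable _ _)]
    simp only [zero_mul, zero_div, hw.at_zero]
    ring
  have hinter : Set.Ioc 0 a ∩ Set.Ioc 0 (1 / 2) = Set.Ioc (0 : ℝ) a :=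
    Set.inter_eq_left.2 (Set.Ioc_subset_Ioc_right ha')
  rw [Measure.real, intensity, Measure.prod_apply hm,
    setLIntegral_congr_fun measurableSet_Ioc hslice, lintegral_indicator measurableSet_Ioc,
    Measure.restrict_restrict measurableSet_Ioc, hinter,
    ← ofReal_integral_eq_lintegral_ofReal (hcont.integrableOn_Ioc) hae,
    ENNReal.toReal_ofReal (integral_nonneg_of_ae hae), ← intervalIntegral.integral_of_le ha, hint]

/-- If the larger coordinate is at most `b`, so is the smaller, so this is the case `a = b` of
`measureReal_intensity_le_le`. -/
lemma measureReal_intensity_div_le (hw : IsProfile k z w) {b : ℝ} (hb : 0 ≤ b) (hb' : b ≤ 1 / 2) :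
    hw.intensity.real {y | y.1 / y.2 ≤ b} = b * (1 - z) / 2 := by
  have h := hw.measureReal_intensity_le_le hb le_rfl hb'
  have hz : b * w (b / b) = b * z := by
    rcases hb.eq_or_lt with rfl | hb
    · simp
    · rw [div_self hb.ne', hw.at_one]
  rw [hz] at h
  rw [← measureReal_congr (s := {y | y.1 ≤ b ∧ y.1 / y.2 ≤ b}), h]
  · ring
  · filter_upwards [hw.ae_intensity] with y hy
    refine propext ⟨fun h => h.2, fun h => ⟨?_, h⟩⟩
    have h1 : y.1 ≤ y.1 / y.2 := by
      rw [le_div_iff₀ hy.2.1]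
      exact mul_le_of_le_one_right hy.1.1.le hy.2.2
    exact h1.trans h

end IsProfile

/-! ### Levels: the distribution and quantile functions of burning times. -/

/-- The probability that the burning time is at most `t`. -/
noncomputable def burnCDF (t : ℝ) : ℝ := 1 - (max 1 (2 * t))⁻¹

lemma burnCDF_of_le {t : ℝ} (ht : t ≤ 1 / 2) : burnCDF t = 0 := by
  rw [burnCDF, max_eq_left (by linarith)]
  norm_num

lemma burnCDF_of_ge {t : ℝ} (ht : 1 / 2 ≤ t) : burnCDF t = 1 - (2 * t)⁻¹ := by
  rw [burnCDF, max_eq_right (by linarith)]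

lemma monotone_burnCDF : Monotone burnCDF := by
  intro s t h
  have : (max 1 (2 * t))⁻¹ ≤ (max 1 (2 * s))⁻¹ :=
    inv_anti₀ (by positivity) (max_le_max le_rfl (by linarith))
  unfold burnCDF
  linarith

lemma burnCDF_nonneg (t : ℝ) : 0 ≤ burnCDF t := by
  have : (max 1 (2 * t))⁻¹ ≤ 1 := inv_le_one_of_one_le₀ (le_max_left _ _)
  unfold burnCDF
  linarith

lemma burnCDF_one : burnCDF 1 = 1 / 2 := by
  rw [burnCDF_of_ge (by norm_num)]
  norm_num

lemma burnCDF_le_half {t : ℝ} (ht : t ≤ 1) : burnCDF t ≤ 1 / 2 :=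
  (monotone_burnCDF ht).trans_eq burnCDF_one

/-- The quantile function of the law of burning times. -/
noncomputable def burnOfLevel (a : ℝ) : BurnTime :=
  if a ≤ 1 / 2 then
    ((Set.projIcc (0 : ℝ) 1 zero_le_one (1 / (2 * (1 - a))) : unitInterval) : BurnTime)
  else ⊤

lemma measurable_burnOfLevel : Measurable burnOfLevel := by
  unfold burnOfLevel
  refine Measurable.ite measurableSet_Iic ?_ measurable_const
  refine Measurable.withTop_coe (continuous_projIcc.measurable.comp ?_)
  exact measurable_const.div (measurable_const.mul (measurable_const.sub measurable_id))

/-- Positivity of `a` matters: level `0` is sent to time `1/2`, although `burnCDF` already vanishes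
at all earlier times. -/
lemma burnOfLevel_le_coe_iff {a : ℝ} (ha : 0 < a) (t : unitInterval) :
    burnOfLevel a ≤ (t : BurnTime) ↔ a ≤ burnCDF t := by
  have ht0 : (0 : ℝ) ≤ t := t.2.1
  have ht1 : (t : ℝ) ≤ 1 := t.2.2
  unfold burnOfLevel
  split_ifs with h
  · have h1 : 0 < 2 * (1 - a) := by linarith
    have hm : (1 / (2 * (1 - a))) ∈ Set.Icc (0 : ℝ) 1 := by
      constructor
      · positivity
      · rw [div_le_one h1]; linarith
    rw [Set.projIcc_of_mem zero_le_one hm, WithTop.coe_le_coe, ← Subtype.coe_le_coe]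
    show 1 / (2 * (1 - a)) ≤ (t : ℝ) ↔ _
    rw [div_le_iff₀ h1]
    rcases le_total (t : ℝ) (1 / 2) with h2 | h2
    · rw [burnCDF_of_le h2]
      constructor <;> intro h3 <;> nlinarith
    · rw [burnCDF_of_ge h2, le_sub_comm, inv_le_iff_one_le_mul₀ (by linarith)]
      constructor <;> intro h3 <;> linarith
  · simp only [top_le_iff, WithTop.coe_ne_top, false_iff, not_le]
    exact (burnCDF_le_half ht1).trans_lt (not_le.1 h)

/-! ### The coupling, its marginals and its joint distribution function. -/

namespace IsProfile

variable {k z : ℝ} {w : ℝ → ℝ}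

/-- A law on pairs of burning times with both marginals `burnLaw`. -/
noncomputable def coupling (hw : IsProfile k z w) : Measure (BurnTime × BurnTime) :=
  hw.intensity.map (fun y => (burnOfLevel y.1, burnOfLevel (y.1 / y.2)))
    + hw.intensity.map (fun y => (burnOfLevel (y.1 / y.2), burnOfLevel y.1))
    + ENNReal.ofReal ((1 - z) / 2) • Measure.dirac (⊤, ⊤)

lemma measurable_burnOfLevel_fst : Measurable fun y : ℝ × ℝ => burnOfLevel y.1 :=
  measurable_burnOfLevel.comp measurable_fst

lemma measurable_burnOfLevel_div : Measurable fun y : ℝ × ℝ => burnOfLevel (y.1 / y.2) :=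
  measurable_burnOfLevel.comp (measurable_fst.div measurable_snd)

instance (hw : IsProfile k z w) : IsFiniteMeasure hw.coupling := by
  have : IsFiniteMeasure (ENNReal.ofReal ((1 - z) / 2) •
      Measure.dirac ((⊤, ⊤) : BurnTime × BurnTime)) := Measure.smul_finite _ ENNReal.ofReal_ne_top
  unfold coupling
  infer_instance

lemma measureReal_coupling (hw : IsProfile k z w) {E : Set (BurnTime × BurnTime)}
    (hE : MeasurableSet E) :
    hw.coupling.real E = hw.intensity.real {y | (burnOfLevel y.1, burnOfLevel (y.1 / y.2)) ∈ E}
      + hw.intensity.real {y | (burnOfLevel (y.1 / y.2), burnOfLevel y.1) ∈ E}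
      + E.indicator (fun _ => (1 - z) / 2) (⊤, ⊤) := by
  have h1 := measurable_burnOfLevel_fst.prodMk measurable_burnOfLevel_div
  have h2 := measurable_burnOfLevel_div.prodMk measurable_burnOfLevel_fst
  have h3 : 0 ≤ (1 - z) / 2 := by linarith [hw.z_le_one]
  have : IsFiniteMeasure (ENNReal.ofReal ((1 - z) / 2) •
      Measure.dirac ((⊤, ⊤) : BurnTime × BurnTime)) := Measure.smul_finite _ ENNReal.ofReal_ne_top
  rw [coupling, measureReal_add_apply, measureReal_add_apply, map_measureReal_apply h1 hE,
    map_measureReal_apply h2 hE, measureReal_ennreal_smul_apply, ENNReal.toReal_ofReal h3]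
  congr 1
  by_cases h : ((⊤, ⊤) : BurnTime × BurnTime) ∈ E
  · simp [Measure.real, Measure.dirac_apply' _ hE, h]
  · simp [Measure.real, Measure.dirac_apply' _ hE, h]

instance (hw : IsProfile k z w) : IsProbabilityMeasure hw.coupling := by
  refine ⟨?_⟩
  have h := hw.measureReal_coupling MeasurableSet.univ
  simp only [Set.mem_univ, Set.ofPred_true, measureReal_intensity_univ, Set.indicator_univ] at h
  have h1 : hw.coupling.real Set.univ = 1 := by rw [h]; ring
  rwa [Measure.real, ENNReal.toReal_eq_one_iff] at h1

lemma coupling_map_swap (hw : IsProfile k z w) : hw.coupling.map Prod.swap = hw.coupling := by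
  have h1 := measurable_burnOfLevel_fst.prodMk measurable_burnOfLevel_div
  have h2 := measurable_burnOfLevel_div.prodMk measurable_burnOfLevel_fst
  rw [coupling, Measure.map_add _ _ measurable_swap, Measure.map_add _ _ measurable_swap,
    Measure.map_map measurable_swap h1, Measure.map_map measurable_swap h2, Measure.map_smul,
    Measure.map_dirac' measurable_swap, add_comm (hw.intensity.map _)]
  rfl

/-- At level `a`, the first coordinate contributes `a * (z + 1) / 2` as the smaller one and `a * (1
- z) / 2` as the larger one, so `z` cancels. -/
lemma measureReal_coupling_le_univ (hw : IsProfile k z w) (t : unitInterval) :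
    hw.coupling.real (Set.Iic (t : BurnTime) ×ˢ Set.univ) = burnCDF t := by
  have hc0 := burnCDF_nonneg t
  have hc1 := burnCDF_le_half t.2.2
  rw [measureReal_coupling _ (measurableSet_Iic.prod MeasurableSet.univ),
    measureReal_congr (t := {y | y.1 ≤ burnCDF t}),
    measureReal_congr (s := {y : ℝ × ℝ | (burnOfLevel (y.1 / y.2), burnOfLevel y.1) ∈
      Set.Iic (t : BurnTime) ×ˢ Set.univ}) (t := {y | y.1 / y.2 ≤ burnCDF t}),
    measureReal_intensity_fst_le _ hc0 hc1, measureReal_intensity_div_le _ hc0 hc1]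
  · rw [Set.indicator_of_notMem (by simp)]
    ring
  · filter_upwards [hw.ae_intensity] with y hy
    have := burnOfLevel_le_coe_iff (div_pos hy.1.1 hy.2.1) t
    exact propext ((and_iff_left trivial).trans this)
  · filter_upwards [hw.ae_intensity] with y hy
    have := burnOfLevel_le_coe_iff hy.1.1 t
    exact propext ((and_iff_left trivial).trans this)

/-- In the swapped part the first coordinate carries the larger level, so the bound on the second
one is automatic. Its mass cancels the term `a * (z - 1) / 2` coming from the other part. -/
lemma measureReal_coupling_le_le_of_le (hw : IsProfile k z w) {s t : unitInterval} (hst : s ≤ t) :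
    hw.coupling.real (Set.Iic (s : BurnTime) ×ˢ Set.Iic (t : BurnTime))
      = burnCDF t - burnCDF t * w (burnCDF s / burnCDF t) := by
  have hs0 := burnCDF_nonneg s
  have hs1 := burnCDF_le_half s.2.2
  have hle : burnCDF s ≤ burnCDF t := monotone_burnCDF hst
  rw [measureReal_coupling _ (measurableSet_Iic.prod measurableSet_Iic),
    measureReal_congr (t := {y | y.1 ≤ burnCDF s ∧ y.1 / y.2 ≤ burnCDF t}),
    measureReal_congr (s := {y : ℝ × ℝ | (burnOfLevel (y.1 / y.2), burnOfLevel y.1) ∈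
      Set.Iic (s : BurnTime) ×ˢ Set.Iic (t : BurnTime)}) (t := {y | y.1 / y.2 ≤ burnCDF s}),
    measureReal_intensity_le_le _ hs0 hle hs1, measureReal_intensity_div_le _ hs0 hs1]
  · rw [Set.indicator_of_notMem (by simp)]
    ring
  · filter_upwards [hw.ae_intensity] with y hy
    have h1 := burnOfLevel_le_coe_iff (div_pos hy.1.1 hy.2.1) s
    have h2 := burnOfLevel_le_coe_iff hy.1.1 t
    refine propext ((and_congr h1 h2).trans ⟨fun h => h.1, fun h => ⟨h, ?_⟩⟩)
    have h3 : y.1 ≤ y.1 / y.2 := by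
      rw [le_div_iff₀ hy.2.1]
      exact mul_le_of_le_one_right hy.1.1.le hy.2.2
    exact h3.trans ((show y.1 / y.2 ≤ burnCDF s from h).trans hle)
  · filter_upwards [hw.ae_intensity] with y hy
    have h1 := burnOfLevel_le_coe_iff (div_pos hy.1.1 hy.2.1) t
    have h2 := burnOfLevel_le_coe_iff hy.1.1 s
    exact propext (and_congr h2 h1)

lemma measureReal_coupling_prod_comm (hw : IsProfile k z w) {A B : Set BurnTime}
    (hA : MeasurableSet A) (hB : MeasurableSet B) :
    hw.coupling.real (A ×ˢ B) = hw.coupling.real (B ×ˢ A) := by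
  conv_lhs => rw [← hw.coupling_map_swap]
  rw [map_measureReal_apply measurable_swap (hA.prod hB), Set.preimage_swap_prod]

lemma measureReal_coupling_univ_le (hw : IsProfile k z w) (t : unitInterval) :
    hw.coupling.real (Set.univ ×ˢ Set.Iic (t : BurnTime)) = burnCDF t := by
  rw [hw.measureReal_coupling_prod_comm MeasurableSet.univ measurableSet_Iic,
    measureReal_coupling_le_univ]

lemma coupling_map_fst (hw : IsProfile k z w) : hw.coupling.map Prod.fst = burnLaw := by
  have : IsProbabilityMeasure (hw.coupling.map Prod.fst) :=
    Measure.isProbabilityMeasure_map measurable_fst.aemeasurable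
  rw [eq_burnLaw_iff]
  intro t
  have h1 : (hw.coupling.map Prod.fst).real (Set.Iic (t : BurnTime)) = burnCDF t := by
    rw [map_measureReal_apply measurable_fst measurableSet_Iic,
      ← hw.measureReal_coupling_le_univ t, Set.prod_univ]
  have h2 : (hw.coupling.map Prod.fst).real (Set.Ioi (t : BurnTime)) = 1 - burnCDF t := by
    rw [← Set.compl_Iic, probReal_compl_eq_one_sub measurableSet_Iic, h1]
  rw [← ofReal_measureReal, h2, burnCDF, sub_sub_cancel,
    ENNReal.ofReal_inv_of_pos (by positivity)]
  rw [ENNReal.ofReal_max, ENNReal.ofReal_mul (by norm_num), one_div]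
  rcases le_total (1 : ENNReal) (2 * ENNReal.ofReal t) with h | h
  · simp [h]
  · simp [h]

lemma coupling_map_snd (hw : IsProfile k z w) : hw.coupling.map Prod.snd = burnLaw := by
  rw [← hw.coupling_map_fst]
  conv_rhs => rw [← hw.coupling_map_swap]
  rw [Measure.map_map measurable_fst measurable_swap]
  rfl

/-- The coupling is not concentrated on the diagonal. -/
lemma coupling_top_compl_ne_zero (hw : IsProfile k z w) :
    hw.coupling ({⊤} ×ˢ {⊤}ᶜ) ≠ 0 := by
  have htop : ({⊤}ᶜ : Set BurnTime) = Set.Iic ((1 : unitInterval) : BurnTime) := by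
    ext x
    induction x using WithTop.recTopCoe with
    | top => simp
    | coe x => simpa using unitInterval.le_one'
  -- The mass in question is `1 / 2 - (1 / 2 - z / 2) = z / 2`.
  have h1 := hw.measureReal_coupling_univ_le 1
  have h2 := hw.measureReal_coupling_le_le_of_le (s := 1) (t := 1) le_rfl
  have h3 : hw.coupling.real (Set.univ ×ˢ {⊤}ᶜ)
      = hw.coupling.real ({⊤} ×ˢ {⊤}ᶜ) + hw.coupling.real ({⊤}ᶜ ×ˢ {⊤}ᶜ) := by
    rw [← measureReal_union _ ((measurableSet_singleton _).compl.prod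
      (measurableSet_singleton _).compl), ← Set.union_prod, Set.union_compl_self]
    exact Set.disjoint_prod.2 (Or.inl disjoint_compl_right)
  rw [htop] at h3
  rw [h1, h2, Set.Icc.coe_one, burnCDF_one, div_self (by norm_num), hw.at_one] at h3
  intro h0
  rw [htop] at h0
  rw [Measure.real, h0] at h3
  have := hw.z_pos
  simp at h3
  linarith

end IsProfile

/-! ### Invariance of the coupling -/

namespace IsProfile

variable {k z : ℝ} {w : ℝ → ℝ}

/-- The joint tail function of the coupling. -/
noncomputable def tail (_ : IsProfile k z w) (s t : ℝ) : ℝ :=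
  1 - min (burnCDF s) (burnCDF t)
    - max (burnCDF s) (burnCDF t) * w (min (burnCDF s) (burnCDF t) / max (burnCDF s) (burnCDF t))

lemma tail_comm (hw : IsProfile k z w) (s t : ℝ) : hw.tail s t = hw.tail t s := by
  rw [tail, tail, min_comm, max_comm]

lemma tail_of_le (hw : IsProfile k z w) {s t : ℝ} (h : s ≤ t) :
    hw.tail s t = 1 - burnCDF s - burnCDF t * w (burnCDF s / burnCDF t) := by
  rw [tail, min_eq_left (monotone_burnCDF h), max_eq_right (monotone_burnCDF h)]

lemma mul_div_self (hw : IsProfile k z w) (b : ℝ) : b * w (b / b) = b * z := by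
  rcases eq_or_ne b 0 with rfl | hb
  · simp
  · rw [div_self hb, hw.at_one]

lemma tail_self (hw : IsProfile k z w) (s : ℝ) :
    hw.tail s s = 1 - burnCDF s - burnCDF s * z := by
  rw [hw.tail_of_le le_rfl, hw.mul_div_self]

/-- This is the analytic form of invariance. For `u ≤ 1 / 2` the integrand is constant, since
nothing burns before that time; beyond it, the differential equation for `w` supplies a primitive.
-/
lemma integral_tail_of_le (hw : IsProfile k z w) {s t : ℝ} (hs : 0 ≤ s) (hst : s ≤ t) :
    ∫ u in (0 : ℝ)..s, (hw.tail u u ^ 2 - hw.tail s u ^ 2 - hw.tail u t ^ 2 + hw.tail s t ^ 2)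
      = hw.tail s t - 1 + burnCDF s + burnCDF t := by
  set φ : ℝ → ℝ :=
    fun u => hw.tail u u ^ 2 - hw.tail s u ^ 2 - hw.tail u t ^ 2 + hw.tail s t ^ 2 with hφ
  set a := burnCDF s with ha
  set b := burnCDF t with hb
  have hab : a ≤ b := monotone_burnCDF hst
  have hlow : ∀ u, u ≤ 1 / 2 → ∀ v, u ≤ v → hw.tail u v = 1 - burnCDF v := by
    intro u hu v huv
    rw [hw.tail_of_le huv, burnCDF_of_le hu, zero_div, hw.at_zero]
    ring
  have hφlow : ∀ u, u ≤ 1 / 2 → u ≤ s →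
      φ u = 1 - (1 - a) ^ 2 - (1 - b) ^ 2 + hw.tail s t ^ 2 := by
    intro u hu hus
    simp only [hφ]
    rw [hw.tail_comm s u, hlow u hu u le_rfl, hlow u hu s hus, hlow u hu t (hus.trans hst),
      burnCDF_of_le hu]
    ring
  rcases le_or_gt s (1 / 2) with h | h
  · have e : Set.EqOn φ (fun _ => 0) (Set.uIcc 0 s) := by
      intro u hu
      rw [Set.uIcc_of_le hs] at hu
      show φ u = 0
      rw [hφlow u (hu.2.trans h) hu.2, hlow s h t hst, ha, burnCDF_of_le h]
      ring
    rw [intervalIntegral.integral_congr e, hlow s h t hst, ha, burnCDF_of_le h, ← hb]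
    simp
  have ha0 : 0 < a := by
    rw [ha, burnCDF_of_ge h.le, sub_pos]
    exact inv_lt_one_of_one_lt₀ (by linarith)
  have hb0 : 0 < b := ha0.trans_le hab
  set c : ℝ → ℝ := fun u => 1 - (2 * u)⁻¹ with hc
  set f := hw.tail s t with hf
  -- A primitive of the integrand on `[1/2, s]`, where `c u` is the level of `u`.
  set E : ℝ → ℝ := fun u => u * (z ^ 2 * c u ^ 2 - (a * w (c u / a)) ^ 2 - (b * w (c u / b)) ^ 2
    + f ^ 2) - c u / 2 with hE
  have hφhigh : ∀ u, 1 / 2 ≤ u → u ≤ s → φ u = (1 - c u - c u * z) ^ 2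
      - (1 - c u - a * w (c u / a)) ^ 2 - (1 - c u - b * w (c u / b)) ^ 2 + f ^ 2 := by
    intro u hu hus
    simp only [hφ]
    rw [hw.tail_comm s u, hw.tail_self, hw.tail_of_le hus, hw.tail_of_le (hus.trans hst),
      burnCDF_of_ge hu]
  have hi1 : IntervalIntegrable φ volume 0 (1 / 2) := by
    refine (intervalIntegrable_const
      (c := 1 - (1 - a) ^ 2 - (1 - b) ^ 2 + f ^ 2)).congr fun u hu => ?_
    rw [Set.uIoc_of_le (by norm_num)] at hu
    exact (hφlow u hu.2 (hu.2.trans h.le)).symm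
  have hi2 : IntervalIntegrable φ volume (1 / 2) s := by
    have hcc : ContinuousOn c (Set.uIcc (1 / 2) s) := by
      refine continuousOn_const.sub (ContinuousOn.inv₀ (by fun_prop) fun u hu => ?_)
      rw [Set.uIcc_of_le h.le] at hu
      linarith [hu.1]
    have hwc := hw.continuous
    refine ContinuousOn.intervalIntegrable (u := φ) (ContinuousOn.congr (f := fun u =>
      (1 - c u - c u * z) ^ 2 - (1 - c u - a * w (c u / a)) ^ 2
        - (1 - c u - b * w (c u / b)) ^ 2 + f ^ 2) ?_ fun u hu => ?_)
    · fun_prop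
    · rw [Set.uIcc_of_le h.le] at hu
      exact hφhigh u hu.1 hu.2
  have hEd : ∀ u ∈ Set.uIcc (1 / 2) s, HasDerivAt E (φ u) u := by
    intro u hu
    rw [Set.uIcc_of_le h.le] at hu
    have hu0 : 0 < u := by linarith [hu.1]
    have hcd : HasDerivAt c (2 * (1 - c u) ^ 2) u := by
      have h1 : HasDerivAt (fun u : ℝ => 2 * u) 2 u := by
        simpa using (hasDerivAt_id u).const_mul (2 : ℝ)
      refine ((h1.inv (by positivity)).const_sub 1).congr_deriv ?_
      simp only [hc]
      field_simp
      ring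
    have hA := (hw.hasDerivAt_scale ha0 (c u)).comp u hcd
    have hB := (hw.hasDerivAt_scale hb0 (c u)).comp u hcd
    refine (((hasDerivAt_id u).mul (((((hcd.pow 2).const_mul (z ^ 2)).sub (hA.pow 2)).sub
      (hB.pow 2)).add_const (f ^ 2))).sub (hcd.div_const 2)).congr_deriv ?_
    rw [hφhigh u hu.1 hu.2]
    have hwa := (hw.pos (c u / a)).ne'
    have hwb := (hw.pos (c u / b)).ne'
    have huc' : u * (1 - c u) = 1 / 2 := by simp only [hc]; field_simp; ring
    have h2k := hw.two_mul_k
    -- When a square in `E` is differentiated, the quotient by `w` cancels, leaving only terms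
    -- linear in `w`. The rest follows from `u * (1 - c u) = 1 / 2` and `2 * k = z * (z + 1)`.
    have eA : a * w (c u / a) * (k * (c u / a / w (c u / a))) = k * c u := by field_simp
    have eB : b * w (c u / b) * (k * (c u / b / w (c u / b))) = k * c u := by field_simp
    simp only [id, Function.comp_apply, Pi.pow_apply, Pi.sub_apply]
    linear_combination (-4 * u * (1 - c u) ^ 2) * eA + (-4 * u * (1 - c u) ^ 2) * eB
      + 4 * (1 - c u) * (z ^ 2 * c u + a * w (c u / a) + b * w (c u / b) - 2 * k * c u) * huc'
      + (-2 * (1 - c u) * c u) * h2k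
  have hI1 : ∫ u in (0 : ℝ)..(1 / 2), φ u
      = (1 - (1 - a) ^ 2 - (1 - b) ^ 2 + f ^ 2) / 2 := by
    have e : Set.EqOn φ (fun _ => 1 - (1 - a) ^ 2 - (1 - b) ^ 2 + f ^ 2)
        (Set.uIcc 0 (1 / 2)) := by
      intro u hu
      rw [Set.uIcc_of_le (by norm_num)] at hu
      exact hφlow u hu.2 (hu.2.trans h.le)
    rw [intervalIntegral.integral_congr e, intervalIntegral.integral_const, smul_eq_mul]
    ring
  have hI2 : ∫ u in (1 / 2)..s, φ u = E s - E (1 / 2) :=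
    intervalIntegral.integral_eq_sub_of_hasDerivAt hEd hi2
  rw [← intervalIntegral.integral_add_adjacent_intervals hi1
    hi2, hI1, hI2]
  have hc1 : c (1 / 2) = 0 := by simp only [hc]; norm_num
  have hcs : c s = a := by rw [ha, burnCDF_of_ge h.le]
  have hsa : s * (1 - a) = 1 / 2 := by
    rw [← hcs]; simp only [hc]; field_simp; ring
  have hfa : f = 1 - a - b * w (a / b) := hw.tail_of_le hst
  simp only [hE, hc1, hcs, zero_div, hw.at_zero, div_self ha0.ne', hw.at_one]
  rw [hfa]
  set W := b * w (a / b)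
  linear_combination (1 - a - 2 * W) * hsa

/-- The analogue for a single coordinate: `burnLaw` solves its own recursion. -/
lemma integral_marginal {s : ℝ} (hs : 0 ≤ s) :
    ∫ u in (0 : ℝ)..s, ((1 - burnCDF u) ^ 2 - (1 - burnCDF s) ^ 2) = burnCDF s := by
  set φ : ℝ → ℝ := fun u => (1 - burnCDF u) ^ 2 - (1 - burnCDF s) ^ 2 with hφ
  rcases le_or_gt s (1 / 2) with h | h
  · have e : Set.EqOn φ (fun _ => 0) (Set.uIcc 0 s) := by
      intro u hu
      rw [Set.uIcc_of_le hs] at hu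
      simp only [hφ]
      rw [burnCDF_of_le h, burnCDF_of_le (hu.2.trans h), sub_self]
    rw [intervalIntegral.integral_congr e, burnCDF_of_le h]
    simp
  have hs0 : 0 < s := by linarith
  have e1 : Set.EqOn φ (fun _ => 1 - (1 - burnCDF s) ^ 2) (Set.uIcc 0 (1 / 2)) := by
    intro u hu
    rw [Set.uIcc_of_le (by norm_num)] at hu
    simp only [hφ]
    rw [burnCDF_of_le hu.2]
    norm_num
  have hd : ∀ u ∈ Set.uIcc (1 / 2) s,
      HasDerivAt (fun u => -(4 * u)⁻¹ - (1 - burnCDF s) ^ 2 * u) (φ u) u := by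
    intro u hu
    rw [Set.uIcc_of_le h.le] at hu
    have hu0 : 0 < u := by linarith [hu.1]
    have h1 : HasDerivAt (fun u : ℝ => 4 * u) 4 u := by
      simpa using (hasDerivAt_id u).const_mul (4 : ℝ)
    refine ((h1.inv (by positivity)).neg.sub
      ((hasDerivAt_id u).const_mul ((1 - burnCDF s) ^ 2))).congr_deriv ?_
    simp only [hφ, burnCDF_of_ge hu.1]
    field_simp
    ring
  have hc : Continuous φ := by
    have : Continuous burnCDF := by
      unfold burnCDF
      exact continuous_const.sub ((by fun_prop : Continuous fun t : ℝ => max 1 (2 * t)).inv₀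
        fun t => (zero_lt_one.trans_le (le_max_left _ _)).ne')
    fun_prop
  rw [← intervalIntegral.integral_add_adjacent_intervals (hc.intervalIntegrable 0 (1 / 2))
    (hc.intervalIntegrable (1 / 2) s), intervalIntegral.integral_congr e1,
    intervalIntegral.integral_eq_sub_of_hasDerivAt hd (hc.intervalIntegrable _ _),
    intervalIntegral.integral_const, smul_eq_mul, burnCDF_of_ge h.le]
  field_simp
  ring

end IsProfile

/-! ### The joint recursion and integration over the activation time. -/

lemma frozenMap_le_coe_iff {u : unitInterval} {x y : BurnTime} {s : unitInterval} :
    frozenMap u x y ≤ (s : BurnTime) ↔ (u : BurnTime) < min x y ∧ min x y ≤ s := by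
  unfold frozenMap
  split_ifs with h
  · simp [h]
  · simp [h]

lemma measurable_frozenMap :
    Measurable fun q : unitInterval × BurnTime × BurnTime => frozenMap q.1 q.2.1 q.2.2 := by
  have h : Measurable fun q : unitInterval × BurnTime × BurnTime => min q.2.1 q.2.2 :=
    (measurable_fst.comp measurable_snd).min (measurable_snd.comp measurable_snd)
  exact Measurable.ite (measurableSet_lt measurable_fst.withTop_coe h) h measurable_const

/-- The joint evolution of two families of burning times that use the same activation times. -/
noncomputable def frozenPairMap (t : unitInterval) (x : Fin 2 → BurnTime × BurnTime) : BurnTime × BurnTime :=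
  (frozenMap t (x 0).1 (x 1).1, frozenMap t (x 0).2 (x 1).2)

lemma measurable_frozenPairMap : Measurable (Function.uncurry frozenPairMap) := by
  have h0 : Measurable fun q : unitInterval × (Fin 2 → BurnTime × BurnTime) => q.2 0 :=
    (measurable_pi_apply 0).comp measurable_snd
  have h1 : Measurable fun q : unitInterval × (Fin 2 → BurnTime × BurnTime) => q.2 1 :=
    (measurable_pi_apply 1).comp measurable_snd
  exact (measurable_frozenMap.comp (measurable_fst.prodMk (h0.fst.prodMk h1.fst))).prodMk
    (measurable_frozenMap.comp (measurable_fst.prodMk (h0.snd.prodMk h1.snd)))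

instance : StandardBorelSpace BurnTime := by
  have : SecondCountableTopology BurnTime := inferInstance
  have : CompactSpace BurnTime := inferInstance
  let := TopologicalSpace.metrizableSpaceMetric BurnTime
  infer_instance

lemma measureReal_prod_eq_integral {α β : Type*} [MeasurableSpace α] [MeasurableSpace β]
    (μ : Measure α) (ν : Measure β) [SFinite μ] [IsFiniteMeasure ν] {E : Set (α × β)}
    (hE : MeasurableSet E) : (μ.prod ν).real E = ∫ a, ν.real (Prod.mk a ⁻¹' E) ∂μ := by
  rw [Measure.real, Measure.prod_apply hE]
  exact (integral_toReal (measurable_measure_prodMk_left hE).aemeasurable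
    (Filter.Eventually.of_forall fun _ => measure_lt_top _ _)).symm

lemma integral_unitInterval_ite_lt {m : ℝ} (hm : m ∈ Set.Icc (0 : ℝ) 1) (g : ℝ → ℝ) :
    ∫ u : unitInterval, (if (u : ℝ) < m then g u else 0) = ∫ u in (0 : ℝ)..m, g u := by
  have h1 : Set.Iio m ∩ Set.Icc 0 1 = Set.Ico 0 m := by
    ext x
    simp only [Set.mem_inter_iff, Set.mem_Iio, Set.mem_Icc, Set.mem_Ico]
    exact ⟨fun h => ⟨h.2.1, h.1⟩, fun h => ⟨h.2, h.1, h.2.le.trans hm.2⟩⟩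
  calc ∫ u : unitInterval, (if (u : ℝ) < m then g u else 0)
      = ∫ u in Set.Icc (0 : ℝ) 1, (Set.Iio m).indicator g u :=
        integral_subtype measurableSet_Icc fun u => (Set.Iio m).indicator g u
    _ = ∫ u in (0 : ℝ)..m, g u := by
        rw [integral_indicator measurableSet_Iio, Measure.restrict_restrict measurableSet_Iio, h1,
          integral_Ico_eq_integral_Ioo, ← integral_Ioc_eq_integral_Ioo,
          intervalIntegral.integral_of_le hm.1]

namespace IsProfile

variable {k z : ℝ} {w : ℝ → ℝ}

lemma measureReal_coupling_Ioi_Ioi (hw : IsProfile k z w) (s t : unitInterval) :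
    hw.coupling.real (Set.Ioi (s : BurnTime) ×ˢ Set.Ioi (t : BurnTime)) = hw.tail s t := by
  wlog hst : s ≤ t generalizing s t
  · rw [hw.measureReal_coupling_prod_comm measurableSet_Ioi measurableSet_Ioi, hw.tail_comm]
    exact this t s (le_of_not_ge hst)
  have h1 : (Set.Ioi (s : BurnTime) ×ˢ Set.Ioi (t : BurnTime))
      = ((Set.Iic (s : BurnTime) ×ˢ Set.univ) ∪ (Set.univ ×ˢ Set.Iic (t : BurnTime)))ᶜ := by
    ext y
    simp
  have h2 : (Set.Iic (s : BurnTime) ×ˢ Set.univ) ∩ (Set.univ ×ˢ Set.Iic (t : BurnTime))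
      = Set.Iic (s : BurnTime) ×ˢ Set.Iic (t : BurnTime) := by
    rw [Set.prod_inter_prod, Set.inter_univ, Set.univ_inter]
  have hm1 : MeasurableSet (Set.Iic (s : BurnTime) ×ˢ (Set.univ : Set BurnTime)) :=
    measurableSet_Iic.prod MeasurableSet.univ
  have hm2 : MeasurableSet ((Set.univ : Set BurnTime) ×ˢ Set.Iic (t : BurnTime)) :=
    MeasurableSet.univ.prod measurableSet_Iic
  have h3 := measureReal_union_add_inter (μ := hw.coupling) (s := Set.Iic (s : BurnTime) ×ˢ Set.univ)
    hm2
  rw [h2, hw.measureReal_coupling_le_univ, hw.measureReal_coupling_univ_le,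
    hw.measureReal_coupling_le_le_of_le hst] at h3
  rw [h1, probReal_compl_eq_one_sub (hm1.union hm2), hw.tail_of_le hst]
  linarith

lemma measureReal_coupling_Iic_Iic (hw : IsProfile k z w) (s t : unitInterval) :
    hw.coupling.real (Set.Iic (s : BurnTime) ×ˢ Set.Iic (t : BurnTime))
      = hw.tail s t - 1 + burnCDF s + burnCDF t := by
  wlog hst : s ≤ t generalizing s t
  · rw [hw.measureReal_coupling_prod_comm measurableSet_Iic measurableSet_Iic, hw.tail_comm,
      this t s (le_of_not_ge hst)]
    ring
  rw [hw.measureReal_coupling_le_le_of_le hst, hw.tail_of_le hst]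
  ring

lemma integral_tail (hw : IsProfile k z w) {s t : ℝ} (hs : 0 ≤ s) (ht : 0 ≤ t) :
    ∫ u in (0 : ℝ)..min s t,
      (hw.tail u u ^ 2 - hw.tail s u ^ 2 - hw.tail u t ^ 2 + hw.tail s t ^ 2)
      = hw.tail s t - 1 + burnCDF s + burnCDF t := by
  rcases le_total s t with h | h
  · rw [min_eq_left h, hw.integral_tail_of_le hs h]
  · have := hw.integral_tail_of_le ht h
    rw [min_eq_right h, hw.tail_comm s t, add_right_comm, ← this]
    refine intervalIntegral.integral_congr fun u _ => ?_
    show _ - hw.tail s u ^ 2 - hw.tail u t ^ 2 + _ = _ - hw.tail t u ^ 2 - hw.tail u s ^ 2 + _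
    rw [hw.tail_comm s u, hw.tail_comm u t]
    ring

/-- The event that both pairs of burning times exceed given values. -/
def bothExceed (s t : BurnTime) : Set (Fin 2 → BurnTime × BurnTime) :=
  {x | s < min (x 0).1 (x 1).1 ∧ t < min (x 0).2 (x 1).2}

lemma bothExceed_eq_pi (s t : BurnTime) :
    bothExceed s t = Set.univ.pi fun _ => Set.Ioi s ×ˢ Set.Ioi t := by
  ext x
  simp only [bothExceed, Set.mem_ofPred_eq, lt_min_iff, Set.mem_pi, Set.mem_univ, true_imp_iff,
    Fin.forall_fin_two, Set.mem_prod, Set.mem_Ioi]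
  tauto

lemma measurableSet_bothExceed (s t : BurnTime) : MeasurableSet (bothExceed s t) := by
  rw [bothExceed_eq_pi]
  exact MeasurableSet.univ_pi fun _ => measurableSet_Ioi.prod measurableSet_Ioi

lemma measureReal_bothExceed (hw : IsProfile k z w) (s t : unitInterval) :
    (Measure.pi fun _ : Fin 2 => hw.coupling).real (bothExceed s t) = hw.tail s t ^ 2 := by
  rw [bothExceed_eq_pi, Measure.real, Measure.pi_pi, Fin.prod_univ_two, ENNReal.toReal_mul, sq,
    ← hw.measureReal_coupling_Ioi_Ioi]
  rfl

/-- For each coordinate the minimum over both children must lie above `u` and not above `s` or `t`,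
respectively. Inclusion–exclusion reduces this to joint exceedances, whose probabilities are squares
because the two children are independent. -/
lemma measureReal_preimage_Iic_Iic (hw : IsProfile k z w) (s t u : unitInterval) :
    (Measure.pi fun _ : Fin 2 => hw.coupling).real
      (frozenPairMap u ⁻¹' (Set.Iic (s : BurnTime) ×ˢ Set.Iic (t : BurnTime)))
      = if (u : ℝ) < min (s : ℝ) t then
          hw.tail u u ^ 2 - hw.tail s u ^ 2 - hw.tail u t ^ 2 + hw.tail s t ^ 2 else 0 := by
  have hset : ∀ x, x ∈ frozenPairMap u ⁻¹' (Set.Iic (s : BurnTime) ×ˢ Set.Iic (t : BurnTime)) ↔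
      ((u : BurnTime) < min (x 0).1 (x 1).1 ∧ min (x 0).1 (x 1).1 ≤ s) ∧
        (u : BurnTime) < min (x 0).2 (x 1).2 ∧ min (x 0).2 (x 1).2 ≤ t := fun x =>
    and_congr frozenMap_le_coe_iff frozenMap_le_coe_iff
  split_ifs with h
  · have hus : (u : BurnTime) ≤ s := WithTop.coe_le_coe.2 (lt_min_iff.1 h).1.le
    have hut : (u : BurnTime) ≤ t := WithTop.coe_le_coe.2 (lt_min_iff.1 h).2.le
    have e : frozenPairMap u ⁻¹' (Set.Iic (s : BurnTime) ×ˢ Set.Iic (t : BurnTime))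
        = bothExceed u u \ (bothExceed s u ∪ bothExceed u t) := by
      ext x
      rw [hset]
      simp only [bothExceed, Set.mem_sdiff, Set.mem_union, Set.mem_ofPred_eq, ← not_lt]
      tauto
    have hinter : bothExceed s u ∩ bothExceed u t = bothExceed s t := by
      ext x
      simp only [bothExceed, Set.mem_inter_iff, Set.mem_ofPred_eq]
      exact ⟨fun h => ⟨h.1.1, h.2.2⟩,
        fun h => ⟨⟨h.1, hut.trans_lt h.2⟩, ⟨hus.trans_lt h.1, h.2⟩⟩⟩
    have hsub : bothExceed s u ∪ bothExceed u t ⊆ bothExceed u u := by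
      rintro x (hx | hx)
      · exact ⟨hus.trans_lt hx.1, hx.2⟩
      · exact ⟨hx.1, hut.trans_lt hx.2⟩
    have h3 := measureReal_union_add_inter (μ := Measure.pi fun _ : Fin 2 => hw.coupling)
      (s := bothExceed s u) (measurableSet_bothExceed u t)
    rw [hinter, measureReal_bothExceed, measureReal_bothExceed, measureReal_bothExceed] at h3
    rw [e, measureReal_sdiff hsub ((measurableSet_bothExceed _ _).union
      (measurableSet_bothExceed _ _)), measureReal_bothExceed]
    linarith
  · rw [not_lt, min_le_iff] at h
    have e : frozenPairMap u ⁻¹' (Set.Iic (s : BurnTime) ×ˢ Set.Iic (t : BurnTime)) = ∅ := by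
      refine Set.eq_empty_of_forall_notMem fun x hx => ?_
      rw [hset] at hx
      rcases h with h | h
      · exact absurd (WithTop.coe_lt_coe.1 (hx.1.1.trans_le hx.1.2)) (not_lt.2 h)
      · exact absurd (WithTop.coe_lt_coe.1 (hx.2.1.trans_le hx.2.2)) (not_lt.2 h)
    rw [e, measureReal_empty]

lemma measureReal_preimage_Iic_univ (hw : IsProfile k z w) (s u : unitInterval) :
    (Measure.pi fun _ : Fin 2 => hw.coupling).real
      (frozenPairMap u ⁻¹' (Set.Iic (s : BurnTime) ×ˢ Set.univ))
      = if (u : ℝ) < s then (1 - burnCDF u) ^ 2 - (1 - burnCDF s) ^ 2 else 0 := by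
  set Q : unitInterval → Set (Fin 2 → BurnTime × BurnTime) :=
    fun r => Set.univ.pi fun _ => Set.Ioi (r : BurnTime) ×ˢ Set.univ with hQ
  have hQm : ∀ r, MeasurableSet (Q r) := fun r =>
    MeasurableSet.univ_pi fun _ => measurableSet_Ioi.prod MeasurableSet.univ
  have hmem : ∀ r x, x ∈ Q r ↔ (r : BurnTime) < min (x 0).1 (x 1).1 := fun r x => by
    simp [hQ, Fin.forall_fin_two]
  have hQr : ∀ r : unitInterval,
      (Measure.pi fun _ : Fin 2 => hw.coupling).real (Q r) = (1 - burnCDF r) ^ 2 := fun r => by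
    have h1 : hw.coupling.real (Set.Ioi (r : BurnTime) ×ˢ Set.univ) = 1 - burnCDF r := by
      rw [← hw.measureReal_coupling_le_univ r, ← probReal_compl_eq_one_sub
        (measurableSet_Iic.prod MeasurableSet.univ)]
      congr 1
      ext y
      simp
    rw [hQ, Measure.real, Measure.pi_pi, Fin.prod_univ_two, ENNReal.toReal_mul, sq, ← h1]
    rfl
  have hset : ∀ x, x ∈ frozenPairMap u ⁻¹' (Set.Iic (s : BurnTime) ×ˢ Set.univ) ↔
      (u : BurnTime) < min (x 0).1 (x 1).1 ∧ min (x 0).1 (x 1).1 ≤ s := fun x =>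
    (and_iff_left trivial).trans frozenMap_le_coe_iff
  split_ifs with h
  · have e : frozenPairMap u ⁻¹' (Set.Iic (s : BurnTime) ×ˢ Set.univ) = Q u \ Q s := by
      ext x
      rw [hset, Set.mem_sdiff, hmem, hmem, not_lt]
    have hsub : Q s ⊆ Q u := fun x hx => (hmem u x).2
      ((WithTop.coe_le_coe.2 (show u ≤ s from h.le)).trans_lt ((hmem s x).1 hx))
    rw [e, measureReal_sdiff hsub (hQm s), hQr, hQr]
  · have e : frozenPairMap u ⁻¹' (Set.Iic (s : BurnTime) ×ˢ Set.univ) = ∅ := by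
      refine Set.eq_empty_of_forall_notMem fun x hx => ?_
      rw [hset] at hx
      exact h (show u < s from WithTop.coe_lt_coe.1 (hx.1.trans_le hx.2))
    rw [e, measureReal_empty]

/-- The coupling is invariant under the joint evolution. -/
lemma map_frozenPairMap_coupling (hw : IsProfile k z w) :
    ((volume : Measure unitInterval).prod (Measure.pi fun _ : Fin 2 => hw.coupling)).map
      (Function.uncurry frozenPairMap) = hw.coupling := by
  set m := ((volume : Measure unitInterval).prod (Measure.pi fun _ : Fin 2 => hw.coupling)).map
    (Function.uncurry frozenPairMap) with hm
  have : IsProbabilityMeasure m :=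
    Measure.isProbabilityMeasure_map measurable_frozenPairMap.aemeasurable
  have hreal : ∀ E, MeasurableSet E → m.real E = ∫ u : unitInterval,
      (Measure.pi fun _ : Fin 2 => hw.coupling).real (frozenPairMap u ⁻¹' E) := fun E hE => by
    rw [hm, map_measureReal_apply measurable_frozenPairMap hE,
      measureReal_prod_eq_integral _ _ (measurable_frozenPairMap hE)]
    rfl
  -- The joint map commutes with exchanging the coordinates, so symmetry of the coupling is
  -- inherited; this derives `h3` from `h2`.
  have hswap : m.map Prod.swap = m := by
    have hp : MeasurePreserving (Prod.swap : BurnTime × BurnTime → _) hw.coupling hw.coupling :=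
      ⟨measurable_swap, hw.coupling_map_swap⟩
    have hpp := (MeasurePreserving.id (volume : Measure unitInterval)).prod
      (measurePreserving_pi (fun _ : Fin 2 => hw.coupling) _ fun _ => hp)
    rw [hm, Measure.map_map measurable_swap measurable_frozenPairMap]
    conv_rhs => rw [← hpp.map_eq, Measure.map_map measurable_frozenPairMap hpp.measurable]
    rfl
  have h1 : ∀ s t : unitInterval, m.real (Set.Iic (s : BurnTime) ×ˢ Set.Iic (t : BurnTime))
      = hw.coupling.real (Set.Iic (s : BurnTime) ×ˢ Set.Iic (t : BurnTime)) := by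
    intro s t
    rw [hreal _ (measurableSet_Iic.prod measurableSet_Iic), hw.measureReal_coupling_Iic_Iic,
      ← hw.integral_tail s.2.1 t.2.1, ← integral_unitInterval_ite_lt
        ⟨le_min s.2.1 t.2.1, (min_le_left _ _).trans s.2.2⟩]
    exact integral_congr_ae (Filter.Eventually.of_forall
      fun u => hw.measureReal_preimage_Iic_Iic s t u)
  have h2 : ∀ s : unitInterval, m.real (Set.Iic (s : BurnTime) ×ˢ Set.univ)
      = hw.coupling.real (Set.Iic (s : BurnTime) ×ˢ Set.univ) := by
    intro s
    rw [hreal _ (measurableSet_Iic.prod MeasurableSet.univ), hw.measureReal_coupling_le_univ,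
      ← integral_marginal s.2.1, ← integral_unitInterval_ite_lt s.2]
    exact integral_congr_ae (Filter.Eventually.of_forall
      fun u => hw.measureReal_preimage_Iic_univ s u)
  have h3 : ∀ t : unitInterval, m.real (Set.univ ×ˢ Set.Iic (t : BurnTime))
      = hw.coupling.real (Set.univ ×ˢ Set.Iic (t : BurnTime)) := by
    intro t
    rw [hw.measureReal_coupling_prod_comm MeasurableSet.univ measurableSet_Iic, ← h2]
    conv_lhs => rw [← hswap]
    rw [map_measureReal_apply measurable_swap (MeasurableSet.univ.prod measurableSet_Iic),
      Set.preimage_swap_prod]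
  have h4 : ∀ s t : BurnTime, m (Set.Iic s ×ˢ Set.Iic t) = hw.coupling (Set.Iic s ×ˢ Set.Iic t) := by
    intro s t
    refine (measureReal_eq_measureReal_iff).1 ?_
    induction s using WithTop.recTopCoe with
    | top =>
      induction t using WithTop.recTopCoe with
      | top => simp
      | coe t => simpa only [Set.Iic_top] using h3 t
    | coe s =>
      induction t using WithTop.recTopCoe with
      | top => simpa only [Set.Iic_top] using h2 s
      | coe t => exact h1 s t
  -- Lower quadrants determine the law one coordinate at a time: fix the event for one coordinate
  -- and compare the restricted marginals of the other.
  have h5 : ∀ (s : BurnTime) (B : Set BurnTime), MeasurableSet B →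
      m (Set.Iic s ×ˢ B) = hw.coupling (Set.Iic s ×ˢ B) := by
    intro s B hB
    have e : (m.restrict (Set.Iic s ×ˢ Set.univ)).map Prod.snd
        = (hw.coupling.restrict (Set.Iic s ×ˢ Set.univ)).map Prod.snd := by
      refine Measure.ext_of_Iic _ _ fun t => ?_
      rw [Measure.map_apply measurable_snd measurableSet_Iic,
        Measure.map_apply measurable_snd measurableSet_Iic,
        Measure.restrict_apply (measurable_snd measurableSet_Iic),
        Measure.restrict_apply (measurable_snd measurableSet_Iic)]
      convert h4 s t using 2 <;> ext y <;> simp [and_comm, Prod.le_def]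
    have e' := congrArg (fun μ => μ B) e
    beta_reduce at e'
    rw [Measure.map_apply measurable_snd hB, Measure.map_apply measurable_snd hB,
      Measure.restrict_apply (measurable_snd hB), Measure.restrict_apply (measurable_snd hB)] at e'
    convert e' using 2 <;> ext y <;> simp [and_comm]
  refine Measure.ext_prod fun {A B} hA hB => ?_
  have e : (m.restrict (Set.univ ×ˢ B)).map Prod.fst
      = (hw.coupling.restrict (Set.univ ×ˢ B)).map Prod.fst := by
    refine Measure.ext_of_Iic _ _ fun s => ?_
    rw [Measure.map_apply measurable_fst measurableSet_Iic,
      Measure.map_apply measurable_fst measurableSet_Iic,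
      Measure.restrict_apply (measurable_fst measurableSet_Iic),
      Measure.restrict_apply (measurable_fst measurableSet_Iic)]
    convert h5 s B hB using 2 <;> ext y <;> simp
  have e' := congrArg (fun μ => μ A) e
  beta_reduce at e'
  rw [Measure.map_apply measurable_fst hA, Measure.map_apply measurable_fst hA,
    Measure.restrict_apply (measurable_fst hA), Measure.restrict_apply (measurable_fst hA)] at e'
  convert e' using 2 <;> ext y <;> simp

end IsProfile

/-! ### Conclusion. -/

theorem theoremT :
    (∃ (S : Type) (_ : MeasurableSpace S) (P : Measure S) (_ : IsProbabilityMeasure P)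
      (τ : Word 2 → S → unitInterval) (X : Word 2 → S → BurnTime),
      IsRTP (volume : Measure unitInterval) (fun t x => frozenMap t (x 0) (x 1)) burnLaw P τ X) ∧
    ∀ (S : Type*) [MeasurableSpace S] (P : Measure S) [IsProbabilityMeasure P]
      (τ : Word 2 → S → unitInterval) (X : Word 2 → S → BurnTime),
      IsRTP (volume : Measure unitInterval) (fun t x => frozenMap t (x 0) (x 1)) burnLaw P τ X →
      ¬ IsEndogenous P τ X := by
  obtain ⟨k, z, w, hw⟩ := exists_isProfile
  obtain ⟨S', _, P', _, τ', Z, hZ⟩ :=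
    exists_isRTP measurable_frozenPairMap hw.map_frozenPairMap_coupling
  have hX := hZ.map_state (γ' := fun t x => frozenMap t (x 0) (x 1)) measurable_fst
    hw.coupling_map_fst fun _ _ => rfl
  have hY := hZ.map_state (γ' := fun t x => frozenMap t (x 0) (x 1)) measurable_snd
    hw.coupling_map_snd fun _ _ => rfl
  refine ⟨⟨S', _, P', inferInstance, τ', _, hX⟩, fun S _ P _ τ X h hend => ?_⟩
  have hγ : Measurable (Function.uncurry fun (t : unitInterval) (x : Fin 2 → BurnTime) =>
      frozenMap t (x 0) (x 1)) := by
    have h0 : Measurable fun q : unitInterval × (Fin 2 → BurnTime) => q.2 0 :=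
      (measurable_pi_apply 0).comp measurable_snd
    have h1 : Measurable fun q : unitInterval × (Fin 2 → BurnTime) => q.2 1 :=
      (measurable_pi_apply 1).comp measurable_snd
    exact measurable_frozenMap.comp (measurable_fst.prodMk (h0.prodMk h1))
  have h0 := h.measure_root_ne_eq_zero hγ hend hX hY (measurableSet_singleton (⊤ : BurnTime))
  -- The root is the boundary of the empty subtree, so the pair at the root is distributed according
  -- to the coupling.
  have hroot : P'.map (Z []) = hw.coupling :=
    hZ.map_boundary ∅ (fun _ _ _ hj => absurd hj (Finset.notMem_empty _)) []
      (mem_treeBoundary_empty.2 rfl)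
  refine hw.coupling_top_compl_ne_zero ?_
  rw [← hroot, Measure.map_apply (hZ.measurable_state [])
    ((measurableSet_singleton _).prod (measurableSet_singleton _).compl)]
  exact h0
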